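/- Graphs are finite, undirected and loopless, and may have multiple edges. Let $t\ge 1$ be an integer. A graph is *strictly $t$-degenerate* if every non-empty subgraph $H$ of it has a vertex $v$ with $d_H(v)\le t-1$. The *point partition number* $\chi_t(G)$ is the least integer $k\ge 0$ for which the vertices of $G$ can be colored with $k$ colors so that each color class induces a strictly $t$-degenerate subgraph of $G$. Let $\Delta(G)$ be the maximum degree of $G$, and let $sG$ be the graph obtained from $G$ by replacing each edge by $s$ parallel edges with the same two ends. $K_n$ and $C_n$ denote the complete graph and the cycle of order $n$. A connected graph is understood to be non-empty, and in (a) and (b) below equality of graphs means isomorphism. Theorem. Let $G$ be a connected graph. Then $\chi_t(G)\le \lceil \Delta(G)/t\rceil+1$, and equality holds if and only if at least one of the following holds: (a) $G=sK_{(t/s)p+1}$ for some integers $s,p$ with $1\le s\le t$, $p\ge 0$ and $s\mid t$, and $\chi_t(G)=p+1$; (b) $G=tC_n$ for some odd $n\ge 3$, and $\chi_t(G)=3$; (c) $G$ is a connected $t$-regular graph, and $\chi_t(G)=2$. Moreover, the stated values of $\chi_t$ are automatic: $\chi_t(G)=p+1$ whenever $G=sK_{(t/s)p+1}$ for integers $s,p$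 as in (a), $\chi_t(G)=3$ whenever $G=tC_n$ with $n\ge 3$ odd, and $\chi_t(G)=2$ whenever $G$ is connected and $t$-regular. -/

import Mathlib

open scoped Graph

namespace Graph

/-- The degree of `v` in a loopless multigraph: the number of edges incident with `v`. -/
noncomputable def degree {α β : Type*} (G : Graph α β) (v : α) : ℕ :=
  (G.incidenceSet v).ncard

/-- The maximum degree of a finite multigraph (`0` for the empty graph). -/
noncomputable def maxDegree {α β : Type*} (G : Graph α β) : ℕ :=
  sSup (G.degree '' V(G))

/-- Every vertex has degree `d`. -/
def IsRegularOfDegree {α β : Type*} (G : Graph α β) (d : ℕ) : Prop :=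
  ∀ v ∈ V(G), G.degree v = d

/-- A graph is connected if it is non-empty and any two vertices are joined by a walk. -/
def Connected {α β : Type*} (G : Graph α β) : Prop :=
  V(G).Nonempty ∧ ∀ x ∈ V(G), ∀ y ∈ V(G), Relation.ReflTransGen G.Adj x y

/-- Every non-empty subgraph has a vertex whose degree in that subgraph is at most `t - 1`. -/
def IsStrictlyDegenerate {α β : Type*} (G : Graph α β) (t : ℕ) : Prop :=
  ∀ H : Graph α β, H ≤ G → V(H).Nonempty → ∃ v ∈ V(H), H.degree v < t

/-- A coloring of the vertices of `G` with color set `Γ` such that each color class induces a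
strictly `t`-degenerate subgraph. -/
def IsSDColoring {α β Γ : Type*} (G : Graph α β) (t : ℕ) (φ : V(G) → Γ) : Prop :=
  ∀ c : Γ, (G.induce (Subtype.val '' (φ ⁻¹' {c}))).IsStrictlyDegenerate t

/-- The point partition number: the least `k` such that `G` has a coloring with `k` colors whose
color classes all induce strictly `t`-degenerate subgraphs. (For a finite loopless `G` and `t ≥ 1`
such `k` exist, for instance the number of vertices.) -/
noncomputable def pointPartitionNumber {α β : Type*} (G : Graph α β) (t : ℕ) : ℕ :=
  sInf {k : ℕ | ∃ φ : V(G) → Fin k, G.IsSDColoring t φ}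

/-- The `s`-uniform inflation: each edge is replaced by `s` parallel edges with the same ends. -/
def inflation {α β : Type*} (s : ℕ) (G : Graph α β) : Graph α (β × Fin s) where
  vertexSet := V(G)
  IsLink e x y := G.IsLink e.1 x y
  isLink_symm := by
    rintro e -
    exact ⟨fun x y h => Graph.IsLink.symm h⟩
  eq_or_eq_of_isLink_of_isLink _ _ _ _ _ h h' := h.left_eq_or_eq h'
  left_mem_of_isLink _ _ _ h := h.left_mem

/-- The complete graph of order `n`. -/
def complete (n : ℕ) : Graph (Fin n) (Sym2 (Fin n)) :=
  Graph.ofSimpleGraph (⊤ : SimpleGraph (Fin n))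

/-- The cycle of order `n`, for `n ≥ 3`. -/
def cycle (n : ℕ) : Graph (Fin n) (Sym2 (Fin n)) :=
  Graph.ofSimpleGraph (SimpleGraph.cycleGraph n)

/-- Isomorphism of multigraphs: bijections between the vertices and between the edges that
preserve and reflect incidence. -/
def IsIsomorphic {α β α' β' : Type*} (G : Graph α β) (H : Graph α' β') : Prop :=
  ∃ (f : V(G) ≃ V(H)) (g : E(G) ≃ E(H)), ∀ (e : E(G)) (x y : V(G)),
    G.IsLink (e : β) (x : α) (y : α) ↔ H.IsLink (g e : β') (f x : α') (f y : α')

end Graph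

set_option linter.unusedSectionVars false

/-! Only the numbers of edges between pairs of vertices matter, so the argument is carried out for
`EdgeMult` and transferred to `Graph` at the end. Put k = ⌈Δ/t⌉. A vertex with fewer than jt edges
to the vertices already colored has fewer than t edges to one of j colors (`exists_good_of_sparse`).
Since all degrees are at most kt < (k+1)t, this gives the upper bound. A connected multigraph with
some degree below kt is strictly kt-degenerate (`sparse_univ_of_lt`), so for k ≥ 1 equality forces
it to be kt-regular without a good k-coloring. For k = 0 it is one vertex and for k = 1 it is
t-regular; the substance is k ≥ 2, the `Critical` case.

By connectedness there are colorings that are good outside any prescribed vertex v, the hole. Every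
color then sends exactly t edges to v. The hole can move through its monochromatic component, which
is therefore t-regular, and the color given to the hole is free. Comparing degrees before and after
such moves gives equalities of multiplicities (`Critical.swap`). If the components of v in two
colors stay connected without v and are joined by an edge avoiding v, these equalities make their
union uniform (`Critical.exists_uniformBlock`).

To reach that situation, a `Trail` keeps moving the hole to a non-separating vertex of its component
and flipping that vertex between two colors. At the first return, either a uniform block appears,
which then contains the starting hole, or the starting component is a single pair
(`Critical.uniformBlock_or_pair`). A component that is not a pair makes the blocks at v fit together
into the whole multigraph, which is sK_n (`Critical.uniform_of_not_pair`). If all components are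
pairs, t-regularity makes every multiplicity 0 or t. This is Brooks' theorem for the underlying
simple graph: Kempe chains give tK_n for k ≥ 3 (`Critical.uniform_of_three_le`), and 2-regularity
gives an odd tC_n for k = 2 (`Critical.exists_cycle`).

Conversely, k is computed from the degree in each exceptional case, and short lower bounds show that
k colors do not suffice. -/

/-- A symmetric edge multiplicity function without loops on a vertex type. -/
structure EdgeMult (V : Type*) where
  /-- The number of edges joining two vertices. -/
  m : V → V → ℕ
  symm : ∀ x y, m x y = m y x
  loopless : ∀ x, m x x = 0


/-! ### Degrees, strict degeneracy and greedy coloring -/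

namespace EdgeMult

variable {V Γ : Type*} [Fintype V] [DecidableEq V] [Fintype Γ] [DecidableEq Γ]
  (M : EdgeMult V) {t : ℕ} {A B : Finset V} {c : V → Γ} {u v w x y : V}

/-- The number of edges from `v` to `A`. -/
def degIn (A : Finset V) (v : V) : ℕ := ∑ x ∈ A, M.m v x

/-- The multigraph induced by `A` is strictly `t`-degenerate. -/
def Sparse (t : ℕ) (A : Finset V) : Prop :=
  ∀ B ⊆ A, B.Nonempty → ∃ v ∈ B, M.degIn B v < t

/-- A color class. -/
def cls (c : V → Γ) (a : Γ) : Finset V := Finset.univ.filter fun x => c x = a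

@[simp] lemma mem_cls {a : Γ} : x ∈ cls c a ↔ c x = a := by simp [cls]

/-- All color classes are strictly `t`-degenerate. -/
def Good (t : ℕ) (c : V → Γ) : Prop := ∀ a, M.Sparse t (cls c a)

/-- The set `A` is non-empty and induces a connected multigraph. -/
def Linked (A : Finset V) : Prop :=
  A.Nonempty ∧ ∀ B ⊆ A, B.Nonempty → B ≠ A → ∃ x ∈ B, ∃ y ∈ A, y ∉ B ∧ M.m x y ≠ 0

variable {M}

lemma degIn_mono (h : A ⊆ B) (v : V) : M.degIn A v ≤ M.degIn B v :=
  Finset.sum_le_sum_of_subset h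

lemma degIn_insert_self (A : Finset V) (v : V) : M.degIn (insert v A) v = M.degIn A v := by
  by_cases h : v ∈ A
  · rw [Finset.insert_eq_of_mem h]
  · simp [degIn, Finset.sum_insert h, M.loopless]

lemma degIn_erase_self (A : Finset V) (v : V) : M.degIn (A.erase v) v = M.degIn A v := by
  rw [← degIn_insert_self (A.erase v)]
  by_cases h : v ∈ A
  · rw [Finset.insert_erase h]
  · rw [Finset.erase_eq_of_notMem h, degIn_insert_self]

lemma degIn_erase_add (h : x ∈ A) (v : V) : M.degIn (A.erase x) v + M.m v x = M.degIn A v :=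
  Finset.sum_erase_add _ _ h

lemma m_le_degIn (h : x ∈ A) (v : V) : M.m v x ≤ M.degIn A v :=
  Finset.single_le_sum (f := fun x => M.m v x) (fun _ _ => Nat.zero_le _) h

lemma degIn_insert (h : x ∉ A) (v : V) : M.degIn (insert x A) v = M.m v x + M.degIn A v :=
  Finset.sum_insert h

/-- Two sets containing the same neighbors of `v` give the same degree. -/
lemma degIn_congr (h : ∀ x, M.m v x ≠ 0 → (x ∈ A ↔ x ∈ B)) : M.degIn A v = M.degIn B v := by
  unfold degIn
  rw [← Finset.sum_filter_ne_zero, ← Finset.sum_filter_ne_zero (s := B)]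
  congr 1
  ext x
  simp only [Finset.mem_filter]
  exact ⟨fun ⟨h1, h2⟩ => ⟨(h x h2).1 h1, h2⟩, fun ⟨h1, h2⟩ => ⟨(h x h2).2 h1, h2⟩⟩

lemma exists_adj_of_degIn_pos (h : 0 < M.degIn A v) : ∃ x ∈ A, M.m v x ≠ 0 := by
  by_contra! h'
  rw [degIn, Finset.sum_eq_zero h'] at h
  exact lt_irrefl _ h

/-- If `v` has as many edges to `A ⊆ B` as to `B`, then all its neighbors in `B` are in `A`. -/
lemma mem_of_degIn_le (hAB : A ⊆ B) (h : M.degIn B v ≤ M.degIn A v) (hx : x ∈ B)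
    (hvx : M.m v x ≠ 0) : x ∈ A := by
  by_contra hxA
  have h1 : M.degIn (insert x A) v ≤ M.degIn B v :=
    degIn_mono (Finset.insert_subset hx hAB) v
  rw [degIn_insert hxA] at h1
  omega

lemma Sparse.mono (h : M.Sparse t B) (hAB : A ⊆ B) : M.Sparse t A :=
  fun C hC hn => h C (hC.trans hAB) hn

lemma Sparse.insert (h : M.Sparse t A) (hv : M.degIn A v < t) : M.Sparse t (insert v A) := by
  intro B hB hn
  by_cases hvB : v ∈ B
  · refine ⟨v, hvB, lt_of_le_of_lt (degIn_mono hB v) ?_⟩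
    rwa [degIn_insert_self]
  · exact h B ((Finset.subset_insert_iff_of_notMem hvB).1 hB) hn

lemma sum_degIn_cls (c : V → Γ) (v : V) (A : Finset V) :
    ∑ a, M.degIn (A ∩ cls c a) v = M.degIn A v := by
  unfold degIn
  rw [← Finset.sum_fiberwise A c]
  refine Finset.sum_congr rfl fun a _ => Finset.sum_congr ?_ fun _ _ => rfl
  ext x; simp

/-- Remove a vertex with fewer than |Γ|t edges to the rest and color the rest by induction. By
pigeonhole some color sends fewer than t edges to the removed vertex and can take it. -/
lemma exists_forall_sparse_inter [Nonempty Γ] (A : Finset V)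
    (h : M.Sparse (Fintype.card Γ * t) A) : ∃ c : V → Γ, ∀ a, M.Sparse t (A ∩ cls c a) := by
  induction A using Finset.strongInduction with
  | H A ih =>
    by_cases hA : A.Nonempty
    swap
    · rw [Finset.not_nonempty_iff_eq_empty] at hA
      subst hA
      refine ⟨fun _ => Classical.arbitrary Γ, fun a B hB hn => ?_⟩
      simp only [Finset.empty_inter, Finset.subset_empty] at hB
      simp [hB] at hn
    obtain ⟨v, hvA, hv⟩ := h A subset_rfl hA
    obtain ⟨c, hc⟩ := ih (A.erase v) (Finset.erase_ssubset hvA) (h.mono (Finset.erase_subset _ _))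
    obtain ⟨a, ha⟩ : ∃ a, M.degIn (A.erase v ∩ cls c a) v < t := by
      by_contra! hcon
      have h1 : ∑ _a : Γ, t ≤ ∑ a, M.degIn (A.erase v ∩ cls c a) v :=
        Finset.sum_le_sum fun a _ => hcon a
      rw [sum_degIn_cls, degIn_erase_self] at h1
      simp at h1
      omega
    refine ⟨Function.update c v a, fun b => ?_⟩
    by_cases hb : b = a
    · subst hb
      refine ((hc b).insert ha).mono fun x hx => ?_
      by_cases hxv : x = v
      · simp [hxv]
      · simp_all [Function.update_of_ne]
    · refine (hc b).mono fun x hx => ?_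
      by_cases hxv : x = v
      · subst hxv; simp at hx; exact absurd hx.2.symm hb
      · simp_all [Function.update_of_ne]

lemma exists_good_of_sparse [Nonempty Γ] (h : M.Sparse (Fintype.card Γ * t) Finset.univ) :
    ∃ c : V → Γ, M.Good t c := by
  obtain ⟨c, hc⟩ := exists_forall_sparse_inter (Γ := Γ) _ h
  exact ⟨c, fun a => by simpa using hc a⟩

/-! ### Linked sets -/

lemma Linked.insert_adj (hA : M.Linked A) (hx : x ∈ A) (hxy : M.m x y ≠ 0) :
    M.Linked (insert y A) := by
  by_cases hyA : y ∈ A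
  · rwa [Finset.insert_eq_of_mem hyA]
  refine ⟨⟨y, Finset.mem_insert_self _ _⟩, fun B hB hn hne => ?_⟩
  by_cases hBA : A ⊆ B
  · have hyB : y ∉ B := fun hyB => hne (hB.antisymm (Finset.insert_subset hyB hBA))
    exact ⟨x, hBA hx, y, Finset.mem_insert_self _ _, hyB, hxy⟩
  · by_cases hAB : (B ∩ A).Nonempty
    · obtain ⟨z, hz, w, hw, hwB, hzw⟩ := hA.2 (B ∩ A) Finset.inter_subset_right hAB
        (fun h => hBA (Finset.inter_eq_right.1 h))
      refine ⟨z, (Finset.mem_inter.1 hz).1, w, Finset.mem_insert_of_mem hw, fun h => hwB ?_, hzw⟩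
      exact Finset.mem_inter.2 ⟨h, hw⟩
    · obtain ⟨z, hz⟩ := hn
      have hzA : ∀ z ∈ B, z = y := fun z hz => by
        rcases Finset.mem_insert.1 (hB hz) with h | h
        · exact h
        · exact absurd ⟨z, Finset.mem_inter.2 ⟨hz, h⟩⟩ hAB
      have := hzA z hz
      subst this
      exact ⟨z, hz, x, Finset.mem_insert_of_mem hx,
        fun h => hyA (hzA x h ▸ hx), by rwa [M.symm]⟩

lemma linked_singleton (v : V) : M.Linked {v} := by
  refine ⟨Finset.singleton_nonempty v, fun B hB hn hne => ?_⟩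
  rcases Finset.subset_singleton_iff.1 hB with h | h
  · simp [h] at hn
  · exact absurd h hne

/-- A linked set with at least two elements has a non-separating vertex different from `v`. -/
lemma Linked.exists_erase (hA : M.Linked A) (hv : v ∈ A) (hne : A ≠ {v}) :
    ∃ u ∈ A, u ≠ v ∧ M.Linked (A.erase u) := by
  classical
  -- For a largest proper linked subset containing `v`, adding one outside neighbor must already
  -- give `A`; that neighbor is non-separating.
  let F := A.powerset.filter fun C => v ∈ C ∧ C ≠ A ∧ M.Linked C
  have hF : F.Nonempty := ⟨{v}, by simp [F, hv, hne.symm, linked_singleton]⟩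
  obtain ⟨C, hC, hmax⟩ := Finset.exists_max_image F Finset.card hF
  simp only [F, Finset.mem_filter, Finset.mem_powerset] at hC hmax
  obtain ⟨hCA, hvC, hCne, hCl⟩ := hC
  obtain ⟨x, hx, y, hy, hyC, hxy⟩ := hA.2 C hCA ⟨v, hvC⟩ hCne
  have hl := hCl.insert_adj hx hxy
  have heq : insert y C = A := by
    by_contra hcon
    have := hmax (insert y C) ⟨Finset.insert_subset hy hCA, Finset.mem_insert_of_mem hvC, hcon, hl⟩
    rw [Finset.card_insert_of_notMem hyC] at this
    omega
  refine ⟨y, hy, fun h => hyC (h ▸ hvC), ?_⟩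
  rwa [← heq, Finset.erase_insert hyC]

/-- A linked set meeting `B` that has no edge leaving `B` is contained in `B`. -/
lemma Linked.subset_of_closed (hA : M.Linked A) (hx : x ∈ A) (hxB : x ∈ B)
    (h : ∀ y ∈ A, y ∈ B → ∀ z ∈ A, M.m y z ≠ 0 → z ∈ B) : A ⊆ B := by
  by_contra hcon
  obtain ⟨y, hy, z, hz, hzB, hyz⟩ := hA.2 (A ∩ B) Finset.inter_subset_left
    ⟨x, Finset.mem_inter.2 ⟨hx, hxB⟩⟩ (fun h => hcon (Finset.inter_eq_left.1 h))
  rw [Finset.mem_inter] at hy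
  exact hzB (Finset.mem_inter.2 ⟨hz, h y hy.1 hy.2 z hz hyz⟩)

/-! ### Components of color classes -/

open Classical in
/-- The vertex set of the component of `v` in its color class. -/
noncomputable def comp (M : EdgeMult V) (c : V → Γ) (v : V) : Finset V :=
  Finset.univ.filter fun x => Relation.ReflTransGen (fun a b => c a = c b ∧ M.m a b ≠ 0) v x

lemma mem_comp : x ∈ M.comp c v ↔
    Relation.ReflTransGen (fun a b => c a = c b ∧ M.m a b ≠ 0) v x := by simp [comp]

lemma self_mem_comp (c : V → Γ) (v : V) : v ∈ M.comp c v := mem_comp.2 .refl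

lemma mem_comp_of_adj (hx : x ∈ M.comp c v) (hc : c y = c x) (hxy : M.m x y ≠ 0) :
    y ∈ M.comp c v :=
  mem_comp.2 ((mem_comp.1 hx).tail ⟨hc.symm, hxy⟩)

lemma comp_induction {p : V → Prop} (hv : p v)
    (h : ∀ x y, x ∈ M.comp c v → p x → c x = c y → M.m x y ≠ 0 → p y) (hx : x ∈ M.comp c v) :
    p x := by
  have h1 := mem_comp.1 hx
  clear hx
  induction h1 with
  | refl => exact hv
  | tail h2 h3 ih => exact h _ _ (mem_comp.2 h2) ih h3.1 h3.2

lemma color_eq_of_mem_comp (hx : x ∈ M.comp c v) : c x = c v :=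
  comp_induction (p := fun x => c x = c v) rfl (fun _ _ _ h1 h2 _ => h2.symm.trans h1) hx

lemma mem_comp_symm (hx : x ∈ M.comp c v) : v ∈ M.comp c x := by
  rw [mem_comp] at *
  induction hx with
  | refl => exact .refl
  | tail _ h3 ih => exact .head ⟨h3.1.symm, by rw [M.symm]; exact h3.2⟩ ih

lemma mem_comp_trans (hx : x ∈ M.comp c v) (hy : y ∈ M.comp c x) : y ∈ M.comp c v := by
  rw [mem_comp] at *
  exact hx.trans hy

lemma comp_eq_of_mem (hx : x ∈ M.comp c v) : M.comp c x = M.comp c v := by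
  ext y
  exact ⟨mem_comp_trans hx, mem_comp_trans (mem_comp_symm hx)⟩

lemma linked_comp (c : V → Γ) (v : V) : M.Linked (M.comp c v) := by
  refine ⟨⟨v, self_mem_comp c v⟩, fun B hB ⟨z, hz⟩ hne => ?_⟩
  by_contra! hcon
  refine hne (hB.antisymm fun x hx => ?_)
  rw [← comp_eq_of_mem (hB hz)] at hx
  refine comp_induction (p := fun x => x ∈ B) hz (fun a b ha haB hab hm => ?_) hx
  by_contra hb
  exact hm (hcon a haB b (mem_comp_of_adj (hB haB) hab.symm hm) hb)

/-- A linked subset of the color class of `v` meeting the component of `v` is contained in it. -/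
lemma Linked.subset_comp (hA : M.Linked A) (hx : x ∈ A) (hxv : x ∈ M.comp c v)
    (hc : ∀ y ∈ A, c y = c v) : A ⊆ M.comp c v :=
  hA.subset_of_closed hx hxv fun y hy hyv z hz hyz =>
    mem_comp_of_adj hyv ((hc z hz).trans (hc y hy).symm) hyz

lemma degIn_comp (hx : x ∈ M.comp c v) : M.degIn (M.comp c v) x = M.degIn (cls c (c v)) x :=
  degIn_congr fun y hy => by
    rw [mem_cls]
    exact ⟨color_eq_of_mem_comp,
      fun h => mem_comp_of_adj hx (h.trans (color_eq_of_mem_comp hx).symm) hy⟩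

/-! ### Colorings that are good outside one vertex -/

/-- All color classes become strictly `t`-degenerate when `v` is deleted. -/
def Hole (M : EdgeMult V) (t : ℕ) (c : V → Γ) (v : V) : Prop :=
  ∀ a, M.Sparse t ((cls c a).erase v)

/-- A regular multigraph that has no good coloring with color set `Γ`. -/
structure Critical (M : EdgeMult V) (Γ : Type*) [Fintype Γ] [DecidableEq Γ] (t : ℕ) : Prop where
  pos : 0 < t
  reg : ∀ v, M.degIn Finset.univ v = Fintype.card Γ * t
  not_good : ∀ c : V → Γ, ¬ M.Good t c

lemma cls_update_erase (c : V → Γ) (v : V) (a b : Γ) :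
    (cls (Function.update c v b) a).erase v = (cls c a).erase v := by
  ext x
  by_cases hx : x = v <;> simp [hx]

lemma hole_update (b : Γ) : M.Hole t (Function.update c v b) v ↔ M.Hole t c v := by
  simp only [Hole, cls_update_erase]

variable (hM : M.Critical Γ t)
include hM

/-- A color sending fewer than t edges to the hole could absorb it and give a good coloring. So each
color sends at least t, and the total |Γ|t forces equality. -/
lemma Critical.degIn_cls (h : M.Hole t c v) (a : Γ) : M.degIn (cls c a) v = t := by
  have hge : ∀ b, t ≤ M.degIn (cls c b) v := by
    intro b
    by_contra! hlt
    refine hM.not_good (Function.update c v b) fun a => ?_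
    by_cases hab : a = b
    · subst hab
      have := (h a).insert (v := v) (by rwa [degIn_erase_self])
      refine this.mono fun x hx => ?_
      by_cases hxv : x = v
      · simp [hxv]
      · simp_all [Function.update_of_ne]
    · refine (h a).mono fun x hx => ?_
      by_cases hxv : x = v
      · subst hxv; simp at hx; exact absurd hx.symm hab
      · simp_all [Function.update_of_ne]
  have hsum : ∑ b, M.degIn (cls c b) v = ∑ _b : Γ, t := by
    have := sum_degIn_cls (M := M) c v Finset.univ
    simp only [Finset.univ_inter] at this
    rw [this, hM.reg]; simp
  exact ((Finset.sum_eq_sum_iff_of_le fun b _ => hge b).1 hsum.symm a (Finset.mem_univ a)).symm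

/-- Deleting `u` instead of `v` leaves `v` with fewer than t edges in its class, so `v` can be put
back. -/
lemma Critical.hole_of_adj (h : M.Hole t c v) (hc : c u = c v) (huv : M.m v u ≠ 0) :
    M.Hole t c u := by
  intro a
  by_cases ha : a = c v
  · subst ha
    have hne : u ≠ v := by rintro rfl; exact huv (M.loopless _)
    have h1 : M.degIn (((cls c (c v)).erase u).erase v) v < t := by
      rw [degIn_erase_self]
      have := degIn_erase_add (M := M) (A := cls c (c v)) (x := u) (by simp [hc]) v
      rw [hM.degIn_cls h] at this
      omega
    have h2 : M.Sparse t (((cls c (c v)).erase u).erase v) :=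
      (h _).mono (Finset.erase_subset_erase _ (Finset.erase_subset _ _))
    have := h2.insert h1
    rwa [Finset.insert_erase] at this
    simp [hne.symm]
  · refine (h a).mono fun x hx => ?_
    simp only [Finset.mem_erase, mem_cls] at hx ⊢
    exact ⟨fun hxv => ha (hxv ▸ hx.2.symm), hx.2⟩

lemma Critical.hole_of_mem (h : M.Hole t c v) (hx : x ∈ M.comp c v) : M.Hole t c x :=
  comp_induction (p := fun x => M.Hole t c x) h
    (fun _ _ _ h1 h2 h3 => hM.hole_of_adj h1 h2.symm h3) hx

lemma Critical.degIn_comp (h : M.Hole t c v) (hx : x ∈ M.comp c v) :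
    M.degIn (M.comp c v) x = t := by
  rw [EdgeMult.degIn_comp hx, hM.degIn_cls (hM.hole_of_mem h hx)]

/-- If the hole `v` is recolored with `b`, moved to `w` and `w` receives the old color of `v`,
then `v` and `w` are joined by the same number of edges to every vertex in both of the
components concerned. -/
lemma Critical.swap (h : M.Hole t c v) {b : Γ} (hb : b ≠ c v)
    (hw : w ∈ M.comp (Function.update c v b) v) (hwv : w ≠ v)
    (hx : x ∈ M.comp c v)
    (hx' : x ∈ M.comp (Function.update (Function.update c v b) w (c v)) w) :
    M.m x w = M.m x v := by
  have hw1 : M.Hole t (Function.update c v b) w := hM.hole_of_mem ((hole_update b).2 h) hw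
  have hw2 : M.Hole t (Function.update (Function.update c v b) w (c v)) w :=
    (hole_update _).2 hw1
  have hcw : c w = b := by
    have := color_eq_of_mem_comp hw
    simpa [Function.update_of_ne hwv] using this
  have h1 := hM.degIn_cls (hM.hole_of_mem h hx) (c v)
  have h2 := hM.degIn_cls (hM.hole_of_mem hw2 hx') (c v)
  -- The two recolorings replace `v` by `w` in the class. Since `x` has t edges to this class both
  -- before and after, `v` and `w` contribute equally.
  have h3 : cls (Function.update (Function.update c v b) w (c v)) (c v) =
      insert w ((cls c (c v)).erase v) := by
    ext y
    by_cases hyw : y = w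
    · simp [hyw]
    by_cases hyv : y = v
    · simp [hyv, hwv.symm, hb, Function.update_of_ne]
    · simp [hyw, hyv, Function.update_of_ne]
  rw [h3, degIn_insert (by simp [hwv, hcw, hb])] at h2
  have h4 := degIn_erase_add (M := M) (A := cls c (c v)) (x := v) (by simp) x
  omega

end EdgeMult

/-! ### Uniform blocks -/

namespace EdgeMult

variable {V Γ : Type*} [Fintype V] [DecidableEq V] [Fintype Γ] [DecidableEq Γ]
  {M : EdgeMult V} {t s : ℕ} {A B S : Finset V} {c : V → Γ} {a b : Γ} {u v w x y : V}

/-- Any two distinct vertices of `A` are joined by exactly `s` edges. -/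
def Uniform (M : EdgeMult V) (s : ℕ) (A : Finset V) : Prop :=
  ∀ x ∈ A, ∀ y ∈ A, x ≠ y → M.m x y = s

lemma Uniform.degIn (h : M.Uniform s A) (hx : x ∈ A) : M.degIn A x = s * (A.card - 1) := by
  rw [← degIn_erase_self, EdgeMult.degIn, Finset.sum_congr rfl (g := fun _ => s)]
  · simp [Finset.card_erase_of_mem hx, mul_comm]
  · intro y hy
    rw [Finset.mem_erase] at hy
    exact h x hx y hy.2 hy.1.symm

lemma Uniform.mono (h : M.Uniform s B) (hAB : A ⊆ B) : M.Uniform s A :=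
  fun x hx y hy => h x (hAB hx) y (hAB hy)

/-- A uniform set in which every vertex has degree `2 * t` inside the set `S`. -/
structure UniformBlock (M : EdgeMult V) (t s : ℕ) (S B : Finset V) : Prop where
  pos : 0 < s
  subset : B ⊆ S
  uniform : M.Uniform s B
  deg : ∀ x ∈ B, M.degIn B x = 2 * t

lemma degIn_union_cls (hab : a ≠ b) (c : V → Γ) (v : V) :
    M.degIn (cls c a ∪ cls c b) v = M.degIn (cls c a) v + M.degIn (cls c b) v := by
  refine Finset.sum_union (Finset.disjoint_left.2 fun x hx hx' => hab ?_)
  rw [mem_cls] at hx hx'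
  exact hx.symm.trans hx'

lemma union_cls_update (h : c v = a ∨ c v = b) {d : Γ} (hd : d = a ∨ d = b) :
    cls (Function.update c v d) a ∪ cls (Function.update c v d) b = cls c a ∪ cls c b := by
  ext x
  by_cases hx : x = v
  · subst hx; simp [h, hd]
  · simp [hx]

section
variable (hM : M.Critical Γ t)
include hM

/-- Any vertex of the component can be the hole, so it has t + t edges to the two classes. If it
lies in `B`, these are all inside `B`, so the component cannot leave `B`. -/
lemma Critical.comp_subset_of_uniformBlock (h : M.Hole t c v) (hab : a ≠ b)
    (hv : c v = a ∨ c v = b) (hB : M.UniformBlock t s (cls c a ∪ cls c b) B) (hvB : v ∈ B) :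
    M.comp c v ⊆ B := by
  refine (linked_comp c v).subset_of_closed (self_mem_comp c v) hvB fun y hy hyB z hz hyz => ?_
  have h1 := hM.hole_of_mem h hy
  refine mem_of_degIn_le hB.subset ?_ ?_ hyz
  · rw [hB.deg y hyB, degIn_union_cls hab, hM.degIn_cls h1, hM.degIn_cls h1, two_mul]
  · have := color_eq_of_mem_comp hz
    simpa [this] using hv

/-- After `v` and `w` are exchanged, the edge `u w` brings the whole connected remainder of the
component of `v` into that of `w`, so `Critical.swap` applies to each of its vertices. -/
lemma Critical.eq_of_adj (h : M.Hole t c v) (hb : b ≠ c v)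
    (h1 : M.Linked ((M.comp c v).erase v))
    (hu : u ∈ (M.comp c v).erase v) (hw : w ∈ (M.comp (Function.update c v b) v).erase v)
    (huw : M.m u w ≠ 0) (hx : x ∈ (M.comp c v).erase v) : M.m x w = M.m x v := by
  rw [Finset.mem_erase] at hw
  have hcw : c w = b := by
    have := color_eq_of_mem_comp hw.2
    simpa [Function.update_of_ne hw.1] using this
  have hcol : ∀ z ∈ (M.comp c v).erase v,
      Function.update (Function.update c v b) w (c v) z = c v := by
    intro z hz
    rw [Finset.mem_erase] at hz
    have h2 := color_eq_of_mem_comp hz.2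
    have h3 : z ≠ w := by rintro rfl; exact hb (hcw.symm.trans h2)
    simp [h3, hz.1, h2]
  refine hM.swap h hb hw.2 hw.1 (Finset.mem_of_mem_erase hx) ?_
  refine h1.subset_comp hu ?_ ?_ hx
  · refine mem_comp_of_adj (self_mem_comp _ _) ?_ (by rwa [M.symm])
    simp [hcol u hu]
  · intro y hy
    simp [hcol y hy]

/-- For two neighbors `x`, `y` of `v` in the component, moving the hole to `x` and exchanging it
with `w` shows that `y` has as many edges to `x` as to `w`, namely `s`. The closed neighborhood of
`v` in the component is therefore uniform. All its vertices have degree t in it, as `v` does, so no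
edge of the component leaves it. -/
lemma Critical.uniform_comp (h : M.Hole t c v) (hb : b ≠ c v) (hw : c w = b)
    (hsp : s ≠ 0) (hs : ∀ x ∈ (M.comp c v).erase v, M.m x v ≠ 0 → M.m x v = s ∧ M.m x w = s) :
    M.Uniform s (M.comp c v) := by
  have huni : M.Uniform s (insert v (((M.comp c v).erase v).filter fun x => M.m x v ≠ 0)) := by
    intro x hx y hy hxy
    simp only [Finset.mem_insert, Finset.mem_filter] at hx hy
    rcases hx with rfl | hx <;> rcases hy with rfl | hy
    · exact absurd rfl hxy
    · rw [M.symm]; exact (hs y hy.1 hy.2).1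
    · exact (hs x hx.1 hx.2).1
    have hx1 := Finset.mem_erase.1 hx.1
    have hy1 := Finset.mem_erase.1 hy.1
    have hcx := color_eq_of_mem_comp hx1.2
    have hcy := color_eq_of_mem_comp hy1.2
    have hwx : w ≠ x := by rintro rfl; exact hb (hw.symm.trans hcx)
    have hwy : w ≠ y := by rintro rfl; exact hb (hw.symm.trans hcy)
    have := hM.swap (hM.hole_of_mem h hx1.2) (b := b) (w := w) (x := y) (by rwa [hcx]) ?_ hwx ?_ ?_
    · rw [M.symm, ← this]; exact (hs y hy.1 hy.2).2
    · refine mem_comp_of_adj (self_mem_comp _ _) (by simp [hwx, hw]) ?_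
      rw [(hs x hx.1 hx.2).2]; exact hsp
    · rw [comp_eq_of_mem hx1.2]; exact hy1.2
    · refine mem_comp_of_adj (self_mem_comp _ _) ?_ ?_
      · simp [hwy.symm, hxy.symm, hcx, hcy]
      · rw [M.symm, (hs y hy.1 hy.2).2]; exact hsp
  refine huni.mono ?_
  set P := insert v (((M.comp c v).erase v).filter fun x => M.m x v ≠ 0) with hP
  have hPs : P ⊆ M.comp c v := by
    intro z hz
    simp only [hP, Finset.mem_insert, Finset.mem_filter, Finset.mem_erase] at hz
    rcases hz with rfl | hz
    · exact self_mem_comp _ _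
    · exact hz.1.2
  have hvP : v ∈ P := Finset.mem_insert_self _ _
  have hdv : M.degIn P v = t := by
    rw [← hM.degIn_comp h (self_mem_comp c v)]
    refine degIn_congr fun z hz => ⟨fun h => hPs h, fun h => ?_⟩
    have hzv : z ≠ v := by rintro rfl; exact hz (M.loopless _)
    simp [hP, hzv, h, M.symm z v, hz]
  refine (linked_comp c v).subset_of_closed (self_mem_comp c v) hvP fun y hy hyP z hz hyz => ?_
  refine mem_of_degIn_le hPs ?_ hz hyz
  rw [hM.degIn_comp h hy, huni.degIn hyP, ← huni.degIn hvP, hdv]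

/-- If the components of the hole `v` in two colors stay connected when `v` is deleted and are
joined by an edge avoiding `v`, then they form a uniform block. -/
lemma Critical.exists_uniformBlock (h : M.Hole t c v) (hb : b ≠ c v)
    (h1 : M.Linked ((M.comp c v).erase v))
    (h2 : M.Linked ((M.comp (Function.update c v b) v).erase v))
    (hu : u ∈ (M.comp c v).erase v) (hw : w ∈ (M.comp (Function.update c v b) v).erase v)
    (huw : M.m u w ≠ 0) :
    ∃ s B, M.UniformBlock t s (cls c (c v) ∪ cls c b) B ∧ v ∈ B := by
  have h' : M.Hole t (Function.update c v b) v := (hole_update b).2 h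
  have hback : Function.update (Function.update c v b) v (c v) = c := by simp
  have hA : ∀ u' ∈ (M.comp c v).erase v, ∀ w' ∈ (M.comp (Function.update c v b) v).erase v,
      M.m u' w' ≠ 0 → ∀ x ∈ (M.comp c v).erase v, M.m x w' = M.m x v :=
    fun u' hu' w' hw' hne x hx => hM.eq_of_adj h hb h1 hu' hw' hne hx
  have hB : ∀ u' ∈ (M.comp c v).erase v, ∀ w' ∈ (M.comp (Function.update c v b) v).erase v,
      M.m u' w' ≠ 0 → ∀ x ∈ (M.comp (Function.update c v b) v).erase v, M.m x u' = M.m x v :=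
    fun u' hu' w' hw' hne x hx => hM.eq_of_adj h' (b := c v) (by simpa using hb.symm) h2 hw'
      (by rwa [hback]) (by rwa [M.symm]) hx
  have hs1 : M.m u w = M.m u v := hA u hu w hw huw u hu
  have hs2 : M.m u w = M.m w v := by rw [M.symm]; exact hB u hu w hw huw w hw
  -- A neighbor `x` of `v` is adjacent to `w` by `hA`, so `x` may replace `u` in `hB`; both
  -- multiplicities then equal that of `w v`.
  have hK1 : ∀ x ∈ (M.comp c v).erase v, M.m x v ≠ 0 → M.m x v = M.m u w ∧ M.m x w = M.m u w := by
    intro x hx hxv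
    have e1 := hA u hu w hw huw x hx
    have e2 := hB x hx w hw (by rwa [e1]) w hw
    rw [M.symm] at e2
    omega
  have hK2 : ∀ x ∈ (M.comp (Function.update c v b) v).erase v, M.m x v ≠ 0 →
      M.m x v = M.m u w ∧ M.m x u = M.m u w := by
    intro x hx hxv
    have e1 := hB u hu w hw huw x hx
    have e2 := hA u hu x hx (by rwa [M.symm, e1]) u hu
    rw [M.symm] at e2
    omega
  have hcu : c u = c v := color_eq_of_mem_comp (Finset.mem_of_mem_erase hu)
  have huv : u ≠ v := (Finset.mem_erase.1 hu).1
  have hwv : w ≠ v := (Finset.mem_erase.1 hw).1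
  have hcw : c w = b := by
    have := color_eq_of_mem_comp (Finset.mem_of_mem_erase hw)
    simpa [hwv] using this
  have hU1 := hM.uniform_comp h hb hcw huw hK1
  have hU2 := hM.uniform_comp h' (b := c v) (w := u) (by simpa using hb.symm)
    (by simp [huv, hcu]) huw hK2
  -- Both components are uniform, so `y` is a neighbor of `v` and hence of `u` by `hK2`; thus `y`
  -- may replace `w` in `hA`.
  have hcross : ∀ x ∈ (M.comp c v).erase v, ∀ y ∈ (M.comp (Function.update c v b) v).erase v,
      M.m x y = M.m u w := by
    intro x hx y hy
    have hyv := hU2 y (Finset.mem_of_mem_erase hy) v (self_mem_comp _ _) (Finset.mem_erase.1 hy).1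
    have hxv := hU1 x (Finset.mem_of_mem_erase hx) v (self_mem_comp _ _) (Finset.mem_erase.1 hx).1
    rw [hA u hu y hy ?_ x hx, hxv]
    rw [M.symm, (hK2 y hy (by rwa [hyv])).2]
    exact huw
  have hcol1 : ∀ x ∈ M.comp c v, c x = c v := fun x hx => color_eq_of_mem_comp hx
  have hcol2 : ∀ x ∈ M.comp (Function.update c v b) v, x ≠ v → c x = b := fun x hx hxv => by
    have := color_eq_of_mem_comp hx
    simpa [hxv] using this
  have hU : M.Uniform (M.m u w) (M.comp c v ∪ M.comp (Function.update c v b) v) := by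
    intro x hx y hy hxy
    by_cases hxv : x = v
    · subst hxv
      rcases Finset.mem_union.1 hy with hy | hy
      · exact hU1 x (self_mem_comp _ _) y hy hxy
      · exact hU2 x (self_mem_comp _ _) y hy hxy
    by_cases hyv : y = v
    · subst hyv
      rcases Finset.mem_union.1 hx with hx | hx
      · exact hU1 x hx y (self_mem_comp _ _) hxy
      · exact hU2 x hx y (self_mem_comp _ _) hxy
    rcases Finset.mem_union.1 hx with hx | hx <;> rcases Finset.mem_union.1 hy with hy | hy
    · exact hU1 x hx y hy hxy
    · exact hcross x (Finset.mem_erase.2 ⟨hxv, hx⟩) y (Finset.mem_erase.2 ⟨hyv, hy⟩)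
    · rw [M.symm]
      exact hcross y (Finset.mem_erase.2 ⟨hyv, hy⟩) x (Finset.mem_erase.2 ⟨hxv, hx⟩)
    · exact hU2 x hx y hy hxy
  refine ⟨M.m u w, _, ⟨Nat.pos_of_ne_zero huw, ?_, hU, ?_⟩,
    Finset.mem_union_left _ (self_mem_comp c v)⟩
  · intro x hx
    by_cases hxv : x = v
    · simp [hxv]
    rcases Finset.mem_union.1 hx with hx | hx
    · simp [hcol1 x hx]
    · simp [hcol2 x hx hxv]
  · intro x hx
    rw [hU.degIn hx, ← hU.degIn (Finset.mem_union_left _ (self_mem_comp c v)), two_mul]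
    have e1 := hM.degIn_comp h (self_mem_comp c v)
    have e2 := hM.degIn_comp h' (self_mem_comp _ v)
    rw [← degIn_erase_self] at e1
    nth_rewrite 1 [← e1]
    rw [← e2, EdgeMult.degIn, EdgeMult.degIn, EdgeMult.degIn, ← Finset.sum_union]
    · refine Finset.sum_subset_zero_on_sdiff ?_ ?_ (fun _ _ => rfl) |>.symm
      · exact Finset.union_subset_union (Finset.erase_subset _ _) subset_rfl
      · intro z hz
        simp only [Finset.mem_sdiff, Finset.mem_union, Finset.mem_erase] at hz
        have : z = v := by tauto
        rw [this, M.loopless]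
    · rw [Finset.disjoint_left]
      intro z hz hz'
      rw [Finset.mem_erase] at hz
      exact hb ((hcol2 z hz' hz.1).symm.trans (hcol1 z hz.2))

end

end EdgeMult

/-! ### Trails of holes and their first return -/

namespace EdgeMult

variable {V Γ : Type*} [Fintype V] [DecidableEq V] [Fintype Γ] [DecidableEq Γ]
  {M : EdgeMult V} {t s : ℕ} {B : Finset V} {a b : Γ} {v : ℕ → V} {c : ℕ → V → Γ}

/-- A sequence of colorings that are good outside one vertex. Each step flips, between the colors
`a` and `b`, a non-separating vertex of the component of the current hole. -/
structure Trail (M : EdgeMult V) (t : ℕ) (a b : Γ) (v : ℕ → V) (c : ℕ → V → Γ) : Prop where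
  hole : ∀ n, M.Hole t (c n) (v n)
  color : ∀ n, c n (v n) = a ∨ c n (v n) = b
  mem : ∀ n, v (n + 1) ∈ M.comp (c n) (v n)
  ne : ∀ n, v (n + 1) ≠ v n
  linked : ∀ n, M.Linked ((M.comp (c n) (v n)).erase (v (n + 1)))
  step : ∀ n, ∃ d, d ≠ c n (v n) ∧ c (n + 1) = Function.update (c n) (v (n + 1)) d

/-- Since t > 0, the t-regular component of a hole is not a singleton, so it has a non-separating
vertex other than the hole. Being a hole does not depend on its own color, so the step can be
iterated. -/
lemma Critical.exists_trail (hM : M.Critical Γ t) (hab : a ≠ b) {v₀ : V} {c₀ : V → Γ}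
    (h : M.Hole t c₀ v₀) (hc : c₀ v₀ = a ∨ c₀ v₀ = b) :
    ∃ v c, v 0 = v₀ ∧ c 0 = c₀ ∧ M.Trail t a b v c := by
  let σ := {p : V × (V → Γ) // M.Hole t p.2 p.1 ∧ (p.2 p.1 = a ∨ p.2 p.1 = b)}
  have hnext : ∀ p : σ, ∃ q : σ, q.1.1 ∈ M.comp p.1.2 p.1.1 ∧ q.1.1 ≠ p.1.1 ∧
      M.Linked ((M.comp p.1.2 p.1.1).erase q.1.1) ∧
      ∃ d, d ≠ p.1.2 p.1.1 ∧ q.1.2 = Function.update p.1.2 q.1.1 d := by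
    rintro ⟨⟨x, e⟩, hp1, hp2⟩
    dsimp only at hp1 hp2 ⊢
    obtain ⟨y, hy, hyx, hl⟩ := (linked_comp (M := M) e x).exists_erase (self_mem_comp e x) (by
      intro heq
      have := hM.degIn_comp hp1 (self_mem_comp e x)
      rw [heq] at this
      simp [degIn, M.loopless] at this
      exact hM.pos.ne this)
    obtain ⟨d, hd, hd'⟩ : ∃ d, d ≠ e x ∧ (d = a ∨ d = b) := by
      rcases hp2 with h | h
      · exact ⟨b, by rw [h]; exact hab.symm, .inr rfl⟩
      · exact ⟨a, by rw [h]; exact hab, .inl rfl⟩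
    exact ⟨⟨⟨y, Function.update e y d⟩, (hole_update d).2 (hM.hole_of_mem hp1 hy), by simpa⟩,
      hy, hyx, hl, d, hd, rfl⟩
  choose f hf using hnext
  let q : ℕ → σ := fun n => Nat.rec ⟨(v₀, c₀), h, hc⟩ (fun _ p => f p) n
  exact ⟨fun n => (q n).1.1, fun n => (q n).1.2, rfl, rfl, fun n => (q n).2.1, fun n => (q n).2.2,
    fun n => (hf (q n)).1, fun n => (hf (q n)).2.1, fun n => (hf (q n)).2.2.1,
    fun n => (hf (q n)).2.2.2⟩

namespace Trail

lemma color_succ_of_ne (T : M.Trail t a b v c) {n : ℕ} {x : V} (hx : x ≠ v (n + 1)) :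
    c (n + 1) x = c n x := by
  obtain ⟨d, -, hd⟩ := T.step n
  simp [hd, hx]

lemma color_succ_ne (T : M.Trail t a b v c) (n : ℕ) : c (n + 1) (v (n + 1)) ≠ c n (v n) := by
  obtain ⟨d, hd, hd'⟩ := T.step n
  simpa [hd'] using hd

lemma color_next (T : M.Trail t a b v c) (n : ℕ) : c n (v (n + 1)) = c n (v n) :=
  color_eq_of_mem_comp (T.mem n)

lemma color_eq_of_ne (T : M.Trail t a b v c) {i j k : ℕ} (hi : c i (v i) ≠ c j (v j))
    (hk : c k (v k) ≠ c j (v j)) : c i (v i) = c k (v k) := by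
  rcases T.color i with h1 | h1 <;> rcases T.color j with h2 | h2 <;>
    rcases T.color k with h3 | h3 <;> rw [h1, h2] at hi <;> rw [h3, h2] at hk <;>
    first | exact absurd rfl hi | exact absurd rfl hk | exact h1.trans h3.symm

lemma self_mem (T : M.Trail t a b v c) (n : ℕ) : v n ∈ (M.comp (c n) (v n)).erase (v (n + 1)) :=
  Finset.mem_erase.2 ⟨(T.ne n).symm, self_mem_comp _ _⟩

lemma update_back (T : M.Trail t a b v c) (n : ℕ) :
    Function.update (c (n + 1)) (v (n + 1)) (c n (v n)) = c n := by
  obtain ⟨d, -, hd⟩ := T.step n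
  rw [hd, Function.update_idem, ← T.color_next n, Function.update_eq_self]

lemma union_cls (T : M.Trail t a b v c) (n : ℕ) :
    cls (c (n + 1)) a ∪ cls (c (n + 1)) b = cls (c n) a ∪ cls (c n) b := by
  rw [← T.update_back n, union_cls_update (T.color _) (T.color n)]

/-- A uniform block containing a hole of the trail contains its starting point. -/
lemma uniformBlock_zero (T : M.Trail t a b v c) (hM : M.Critical Γ t) (hab : a ≠ b) (n : ℕ)
    (hB : M.UniformBlock t s (cls (c n) a ∪ cls (c n) b) B) (hv : v n ∈ B) :
    M.UniformBlock t s (cls (c 0) a ∪ cls (c 0) b) B ∧ v 0 ∈ B := by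
  induction n with
  | zero => exact ⟨hB, hv⟩
  | succ n ih =>
    rw [T.union_cls] at hB
    refine ih hB ?_
    -- Before its recoloring, the new hole lies in the component of the old one; the block absorbs
    -- this whole component.
    have h1 : M.comp (c n) (v (n + 1)) = M.comp (c n) (v n) := comp_eq_of_mem (T.mem n)
    have := hM.comp_subset_of_uniformBlock (hM.hole_of_mem (T.hole n) (T.mem n)) hab
      (by rw [T.color_next]; exact T.color n) hB hv
    rw [h1] at this
    exact this (self_mem_comp _ _)

/-- There are finitely many vertices, so some hole occurs twice. A hole stays in its component when
the next hole is removed, so its second visit is a hit. -/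
lemma exists_hit (T : M.Trail t a b v c) :
    ∃ j, ∃ i < j, ¬ Disjoint ((M.comp (c i) (v i)).erase (v (i + 1))) (M.comp (c j) (v j)) := by
  obtain ⟨i, j, hij, hv⟩ := Finite.exists_ne_map_eq_of_infinite v
  wlog h : i < j generalizing i j
  · exact this j i hij.symm hv.symm (by omega)
  exact ⟨j, i, h, Finset.not_disjoint_iff.2 ⟨v i, T.self_mem i, hv ▸ self_mem_comp _ _⟩⟩

/-- Up to time `j`, no component of the trail meets what is left of an earlier one. -/
def NoHit (M : EdgeMult V) (v : ℕ → V) (c : ℕ → V → Γ) (j : ℕ) : Prop :=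
  ∀ m < j, ∀ i < m, Disjoint ((M.comp (c i) (v i)).erase (v (i + 1))) (M.comp (c m) (v m))

/-- Step m recolors only a vertex of the component at time m, and this component avoids what is left
of the earlier one. -/
lemma color_of_noHit (T : M.Trail t a b v c) {j i m : ℕ} (hj : NoHit M v c j) (him : i < m)
    (hmj : m ≤ j) {x : V} (hx : x ∈ (M.comp (c i) (v i)).erase (v (i + 1))) :
    c m x = c i (v i) := by
  induction m, Nat.succ_le_of_lt him using Nat.le_induction with
  | base =>
    rw [Nat.succ_eq_add_one, T.color_succ_of_ne (Finset.mem_erase.1 hx).1]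
    exact color_eq_of_mem_comp (Finset.mem_of_mem_erase hx)
  | succ m hm ih =>
    rw [T.color_succ_of_ne]
    · exact ih (by omega) (by omega)
    · rintro rfl
      exact Finset.disjoint_left.1 (hj m (by omega) i (by omega)) hx (T.mem m)

/-- At time i + 1 such a neighbor would have belonged to the component at time i. Later it could
acquire the color only by becoming the hole, and its component would then be a hit. -/
lemma no_edge_of_noHit (T : M.Trail t a b v c) {j i m : ℕ} (hj : NoHit M v c j) (him : i < m)
    (hmj : m < j) {x y : V} (hx : x ∈ (M.comp (c i) (v i)).erase (v (i + 1)))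
    (hy : y ∉ (M.comp (c i) (v i)).erase (v (i + 1))) (hc : c m y = c i (v i)) :
    M.m x y = 0 := by
  induction m, Nat.succ_le_of_lt him using Nat.le_induction with
  | base =>
    by_contra hxy
    rw [Nat.succ_eq_add_one] at hc
    have hyv : y ≠ v (i + 1) := by rintro rfl; exact T.color_succ_ne i hc
    rw [T.color_succ_of_ne hyv] at hc
    refine hy (Finset.mem_erase.2 ⟨hyv, mem_comp_of_adj (Finset.mem_of_mem_erase hx) ?_ hxy⟩)
    rw [hc]; exact (color_eq_of_mem_comp (Finset.mem_of_mem_erase hx)).symm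
  | succ m hm ih =>
    by_cases hyv : y = v (m + 1)
    · by_contra hxy
      subst hyv
      refine Finset.disjoint_left.1 (hj (m + 1) hmj i (by omega)) hx
        (mem_comp_of_adj (self_mem_comp _ _) ?_ (by rwa [M.symm]))
      rw [hc]; exact T.color_of_noHit hj him hmj.le hx
    · exact ih (by omega) (by omega) (by rwa [T.color_succ_of_ne hyv] at hc)

/-- The first return of a trail: what is left of the component at time `i` becomes part of the
component at time `k + 1`. -/
lemma first_return (T : M.Trail t a b v c) (hM : M.Critical Γ t) {i k : ℕ}
    (hj : NoHit M v c (k + 1)) (hik : i < k + 1)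
    (hhit : ¬ Disjoint ((M.comp (c i) (v i)).erase (v (i + 1)))
      (M.comp (c (k + 1)) (v (k + 1)))) :
    i < k ∧ c (k + 1) (v (k + 1)) = c i (v i) ∧
    v (k + 1) ∉ (M.comp (c i) (v i)).erase (v (i + 1)) ∧
    (∀ x ∈ (M.comp (c i) (v i)).erase (v (i + 1)), M.m x (v (k + 1)) = M.m x (v (i + 1))) ∧
    (M.comp (c (k + 1)) (v (k + 1))).erase (v (k + 1)) =
      (M.comp (c i) (v i)).erase (v (i + 1)) := by
  obtain ⟨x₀, hx₀, hx₀'⟩ := Finset.not_disjoint_iff.1 hhit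
  set D := (M.comp (c i) (v i)).erase (v (i + 1)) with hD
  have hcol : ∀ x ∈ D, c (k + 1) x = c i (v i) := fun x hx => T.color_of_noHit hj hik le_rfl hx
  have hκ : c (k + 1) (v (k + 1)) = c i (v i) :=
    (color_eq_of_mem_comp hx₀').symm.trans (hcol x₀ hx₀)
  have hlt : i < k := by
    rcases Nat.lt_succ_iff_lt_or_eq.1 hik with h | rfl
    · exact h
    · exact absurd hκ (T.color_succ_ne _)
  have hvD : v (k + 1) ∉ D := fun h =>
    Finset.disjoint_left.1 (hj k (by omega) i hlt) h (T.mem k)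
  have hno : ∀ x ∈ D, ∀ y ∉ D, y ≠ v (k + 1) → c (k + 1) y = c i (v i) → M.m x y = 0 := by
    intro x hx y hy hyv hc
    rw [T.color_succ_of_ne hyv] at hc
    exact T.no_edge_of_noHit hj hlt (by omega) hx hy hc
  have hsub : D ⊆ M.comp (c (k + 1)) (v (k + 1)) :=
    (T.linked i).subset_comp hx₀ hx₀' fun y hy => (hcol y hy).trans hκ.symm
  -- `x` has t edges in its class at both times. They go to `D` and `v (i + 1)` at time i, and to
  -- `D` and `v (k + 1)` at time k + 1.
  have htwin : ∀ x ∈ D, M.m x (v (k + 1)) = M.m x (v (i + 1)) := by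
    intro x hx
    have e1 : M.degIn D x + M.m x (v (i + 1)) = t :=
      (degIn_erase_add (T.mem i) x).trans (hM.degIn_comp (T.hole i) (Finset.mem_of_mem_erase hx))
    have e2 := hM.degIn_cls (hM.hole_of_mem (T.hole (k + 1)) (hsub hx)) (c i (v i))
    have e3 : M.degIn (insert (v (k + 1)) D) x = M.degIn (cls (c (k + 1)) (c i (v i))) x := by
      refine degIn_congr fun y hy => ?_
      rw [mem_cls, Finset.mem_insert]
      refine ⟨?_, fun h => ?_⟩
      · rintro (rfl | h)
        · exact hκ
        · exact hcol y h
      · by_contra! hcon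
        exact hy (hno x hx y hcon.2 hcon.1 h)
    rw [degIn_insert hvD] at e3
    omega
  refine ⟨hlt, hκ, hvD, htwin, ?_⟩
  have hins : M.comp (c (k + 1)) (v (k + 1)) ⊆ insert (v (k + 1)) D := by
    refine (linked_comp _ _).subset_of_closed (self_mem_comp _ _) (Finset.mem_insert_self _ _) ?_
    intro y hy hyD z hz hyz
    rcases Finset.mem_insert.1 hyD with rfl | hyD
    · refine Finset.mem_insert_of_mem (mem_of_degIn_le hsub ?_ hz hyz)
      rw [hM.degIn_comp (T.hole (k + 1)) hy, ← hM.degIn_comp (T.hole i) (T.mem i),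
        ← degIn_erase_self]
      refine (Finset.sum_congr rfl fun x hx => ?_).le
      rw [M.symm, ← htwin x hx, M.symm]
    · by_contra hcon
      rw [Finset.mem_insert] at hcon
      push Not at hcon
      exact hyz (hno y hyD z hcon.2 hcon.1 ((color_eq_of_mem_comp hz).trans hκ))
  ext y
  rw [Finset.mem_erase]
  refine ⟨fun h => (Finset.mem_insert.1 (hins h.2)).resolve_left h.1, fun h => ⟨?_, hsub h⟩⟩
  rintro rfl
  exact hvD h

/-- At the first return, either a uniform block occurs or the return is to the starting point, whose
component consists of two vertices. -/
lemma uniformBlock_or_pair (T : M.Trail t a b v c) (hM : M.Critical Γ t) {i k : ℕ}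
    (hj : NoHit M v c (k + 1)) (hik : i < k + 1)
    (hhit : ¬ Disjoint ((M.comp (c i) (v i)).erase (v (i + 1)))
      (M.comp (c (k + 1)) (v (k + 1)))) :
    (∃ s B, M.UniformBlock t s (cls (c (k + 1)) a ∪ cls (c (k + 1)) b) B ∧ v (k + 1) ∈ B) ∨
    M.comp (c 0) (v 0) = {v 0, v 1} := by
  obtain ⟨hlt, hκ, hvD, htwin, hD⟩ := T.first_return hM hj hik hhit
  have hprev : M.comp (c k) (v (k + 1)) = M.comp (c k) (v k) := comp_eq_of_mem (T.mem k)
  -- The components of `v (k + 1)` in the two colors are, up to this vertex, what is left at times i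
  -- and k. Both remainders are connected, so an edge between them gives a uniform block.
  by_cases hadj : ∃ u ∈ (M.comp (c i) (v i)).erase (v (i + 1)),
      ∃ w ∈ (M.comp (c k) (v k)).erase (v (k + 1)), M.m u w ≠ 0
  · left
    obtain ⟨u, hu, w, hw, huw⟩ := hadj
    obtain ⟨s, B, hB, hv⟩ := hM.exists_uniformBlock (T.hole (k + 1)) (b := c k (v k))
      (T.color_succ_ne k).symm (by rw [hD]; exact T.linked i)
      (by rw [T.update_back, hprev]; exact T.linked k) (u := u) (w := w)
      (by rwa [hD]) (by rwa [T.update_back, hprev]) huw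
    refine ⟨s, B, ?_, hv⟩
    have h1 := T.color_succ_ne k
    rcases T.color (k + 1) with h2 | h2 <;> rcases T.color k with h3 | h3
    · exact absurd (h2.trans h3.symm) h1
    · rwa [h2, h3] at hB
    · rwa [h2, h3, Finset.union_comm] at hB
    · exact absurd (h2.trans h3.symm) h1
  right
  push Not at hadj
  have hmi := T.mem i
  have hedge : ∃ w ∈ (M.comp (c i) (v i)).erase (v (i + 1)), M.m (v (i + 1)) w ≠ 0 := by
    refine exists_adj_of_degIn_pos ?_
    rw [degIn_erase_self, hM.degIn_comp (T.hole i) hmi]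
    exact hM.pos
  obtain ⟨w, hw, hvw⟩ := hedge
  -- If k = i + 1, then `v (i + 1)` itself lies in the remainder at time k and is adjacent to `w`.
  have hlt' : i + 1 < k := by
    rcases Nat.lt_or_ge (i + 1) k with h | h
    · exact h
    obtain rfl : k = i + 1 := by omega
    exfalso
    refine hvw ?_
    rw [M.symm]
    exact hadj w hw _ (T.self_mem _)
  have hdis : ∀ l m, l < m → m < k + 1 → ∀ x, x ∈ (M.comp (c l) (v l)).erase (v (l + 1)) →
      x ∉ M.comp (c m) (v m) := fun l m hlm hm x hx =>
    Finset.disjoint_left.1 (hj m hm l hlm) hx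
  -- the vertex `v (k + 1)` is not recolored before the last step
  have hfresh : ∀ m, m ≤ k → v m ≠ v (k + 1) := by
    intro m hm heq
    rcases Nat.lt_or_ge m k with h | h
    · exact hdis m k h (by omega) _ (T.self_mem m) (heq ▸ T.mem k)
    · obtain rfl : m = k := by omega
      exact T.ne m heq.symm
  have hcol : ∀ m, m ≤ k → c m (v (k + 1)) = c k (v k) := by
    intro m hm
    induction hm using Nat.decreasingInduction with
    | self => exact T.color_next k
    | of_succ m hm ih =>
      rw [← ih, T.color_succ_of_ne (hfresh (m + 1) (by omega)).symm]
  have hκ' : c k (v k) ≠ c i (v i) := fun h => T.color_succ_ne k (hκ.trans h.symm)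
  -- Given a second neighbor `w'`, move the hole to `w` at time i and exchange it with `v (k + 1)`.
  -- The path through `w'` keeps `v (i + 1)` in the new component, so `v (i + 1)` is adjacent to `v
  -- (k + 1)`. It then lies in the component at time k, which is an earlier hit.
  have huniq : ∀ w' ∈ (M.comp (c i) (v i)).erase (v (i + 1)), M.m (v (i + 1)) w' ≠ 0 →
      w' = w := by
    intro w' hw' hvw'
    by_contra hne
    have hwc := Finset.mem_of_mem_erase hw
    have hcw : c i w = c i (v i) := color_eq_of_mem_comp hwc
    have hcw' : c i w' = c i (v i) := color_eq_of_mem_comp (Finset.mem_of_mem_erase hw')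
    have hvk : v (k + 1) ≠ w := by rintro h; exact hvD (h ▸ hw)
    have hvk' : v (k + 1) ≠ w' := by rintro h; exact hvD (h ▸ hw')
    have hwi : v (i + 1) ≠ w := (Finset.mem_erase.1 hw).1.symm
    have hvi : v (i + 1) ≠ v (k + 1) := hfresh (i + 1) (by omega)
    have hswap := hM.swap (hM.hole_of_mem (T.hole i) hwc) (b := c k (v k)) (w := v (k + 1))
      (x := v (i + 1)) (by rwa [hcw]) ?_ hvk ?_ ?_
    · have h1 : M.m (v (k + 1)) (v (i + 1)) ≠ 0 := by
        rw [M.symm, hswap]; exact hvw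
      have h2 : v (i + 1) ∈ M.comp (c k) (v (k + 1)) := by
        refine mem_comp_of_adj (self_mem_comp _ _) ?_ h1
        have := T.color_of_noHit hj (i := i + 1) (m := k) (by omega) (by omega) (T.self_mem _)
        rw [this, hcol k le_rfl]
        exact T.color_eq_of_ne (T.color_succ_ne i) hκ'
      rw [hprev] at h2
      exact hdis (i + 1) k hlt' (by omega) _ (T.self_mem _) h2
    · refine mem_comp_of_adj (self_mem_comp _ _) ?_ ?_
      · simp [hvk, hcol i (by omega)]
      · rw [htwin w hw, M.symm]; exact hvw
    · rw [comp_eq_of_mem hwc]; exact hmi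
    · refine mem_comp_of_adj (x := w') (mem_comp_of_adj (self_mem_comp _ _) ?_ ?_) ?_ ?_
      · simp [hvk'.symm, hne, hcw, hcw']
      · rw [M.symm, htwin w' hw', M.symm]; exact hvw'
      · simp [hvk'.symm, hne, hwi, hvi, hcw', T.color_next]
      · rwa [M.symm]
  -- hence `v (i + 1)` and `w` are joined by `t` edges
  have hmult : M.m (v (i + 1)) w = t := by
    rw [← hM.degIn_comp (T.hole i) hmi, ← degIn_erase_self, degIn]
    refine (Finset.sum_eq_single_of_mem w hw fun z hz hzw => ?_).symm
    by_contra h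
    exact hzw (huniq z hz h)
  have hpair : M.comp (c i) (v i) ⊆ {w, v (i + 1)} := by
    refine (linked_comp _ _).subset_of_closed (x := v (i + 1)) hmi (by simp) ?_
    intro y hy hyp z hz hyz
    simp only [Finset.mem_insert, Finset.mem_singleton] at hyp ⊢
    rcases hyp with rfl | rfl
    · have : z ∈ ({v (i + 1)} : Finset V) := by
        refine mem_of_degIn_le (Finset.singleton_subset_iff.2 hmi) ?_ hz hyz
        rw [hM.degIn_comp (T.hole i) hy]
        simp [degIn, M.symm _ (v (i + 1)), hmult]
      exact .inr (Finset.mem_singleton.1 this)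
    · refine .inl (huniq z (Finset.mem_erase.2 ⟨?_, hz⟩) hyz)
      rintro rfl
      exact hyz (M.loopless _)
  have hwv : w = v i := by
    have := hpair (self_mem_comp _ (v i))
    simp only [Finset.mem_insert, Finset.mem_singleton] at this
    exact (this.resolve_right (T.ne i).symm).symm
  subst hwv
  rcases Nat.eq_zero_or_pos i with rfl | hi
  · refine hpair.antisymm fun z hz => ?_
    simp only [Finset.mem_insert, Finset.mem_singleton] at hz
    rcases hz with rfl | rfl
    · exact self_mem_comp _ _
    · exact hmi
  exfalso
  -- If i > 0, then `v (k + 1)`, joined to `v i` by t edges and not yet recolored, was already in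
  -- the component at time i - 1. Its occurrence at time k is an earlier hit.
  obtain ⟨l, rfl⟩ : ∃ l, i = l + 1 := ⟨i - 1, by omega⟩
  have h1 : v (k + 1) ∈ M.comp (c l) (v (l + 1)) := by
    refine mem_comp_of_adj (self_mem_comp _ _) ?_ (?_ : M.m _ _ ≠ 0)
    · rw [hcol l (by omega), T.color_next]
      exact T.color_eq_of_ne hκ' (T.color_succ_ne l).symm
    · rw [htwin _ hw, M.symm, hmult]; exact hM.pos.ne'
  rw [comp_eq_of_mem (T.mem l)] at h1
  exact hdis l k (by omega) (by omega) _
    (Finset.mem_erase.2 ⟨(hfresh (l + 1) (by omega)).symm, h1⟩) (T.mem k)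

end Trail

/-- In a critical multigraph, the component of a hole in one color either lies in a uniform block
that uses one further color, or consists of two vertices. -/
lemma Critical.uniformBlock_or_pair (hM : M.Critical Γ t) {c : V → Γ} {v : V}
    (h : M.Hole t c v) (hb : b ≠ c v) :
    (∃ s B, M.UniformBlock t s (cls c (c v) ∪ cls c b) B ∧ v ∈ B) ∨
    ∃ u, M.comp c v = {v, u} := by
  obtain ⟨v', c', rfl, rfl, T⟩ := hM.exists_trail (a := c v) (b := b) hb.symm h (.inl rfl)
  classical
  have hex := T.exists_hit
  have hmin : Trail.NoHit M v' c' (Nat.find hex) := by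
    intro m hm i hi
    by_contra hcon
    exact Nat.find_min hex hm ⟨i, hi, hcon⟩
  obtain ⟨i, hi, hhit⟩ := Nat.find_spec hex
  obtain ⟨k, hk⟩ : ∃ k, Nat.find hex = k + 1 := ⟨Nat.find hex - 1, by omega⟩
  rw [hk] at hmin hi hhit
  rcases T.uniformBlock_or_pair hM hmin hi hhit with ⟨s, B, hB, hv⟩ | h'
  · exact .inl ⟨s, B, T.uniformBlock_zero hM hb.symm _ hB hv⟩
  · exact .inr ⟨_, h'⟩

end EdgeMult

/-! ### From components to the whole multigraph -/

namespace EdgeMult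

variable {V Γ : Type*} [Fintype V] [DecidableEq V] [Fintype Γ] [DecidableEq Γ]
  {M : EdgeMult V} {t s : ℕ} {c : V → Γ} {i j k : Γ} {u v w x y : V}

section
variable (hM : M.Critical Γ t)
include hM

/-- By connectedness, every non-empty set avoiding `v` has an edge leaving it, hence a vertex of
degree below |Γ|t inside it. Greedy coloring of the complement of `v` applies. -/
lemma Critical.exists_hole [Nonempty Γ] (hl : M.Linked Finset.univ) (v : V) :
    ∃ c : V → Γ, M.Hole t c v := by
  obtain ⟨c, hc⟩ := exists_forall_sparse_inter (Γ := Γ) (M := M) (t := t) (Finset.univ.erase v) (by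
    intro B hB hn
    have hne : B ≠ Finset.univ := by
      rintro rfl
      exact absurd (hB (Finset.mem_univ v)) (by simp)
    obtain ⟨x, hx, y, -, hy, hxy⟩ := hl.2 B (Finset.subset_univ _) hn hne
    refine ⟨x, hx, ?_⟩
    have h1 := degIn_mono (M := M) (Finset.subset_univ (insert y B)) x
    rw [degIn_insert hy, hM.reg] at h1
    omega)
  refine ⟨c, fun a => (hc a).mono fun x hx => ?_⟩
  simpa using hx

/-- If some component of a hole is not a pair, the multigraph is uniform. -/
lemma Critical.uniform_of_not_pair (hΓ : 2 ≤ Fintype.card Γ) (hl : M.Linked Finset.univ)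
    (h : M.Hole t c v) (hpair : ¬ ∃ u, M.comp c v = {v, u}) :
    ∃ s, 0 < s ∧ s ∣ t ∧ M.Uniform s Finset.univ := by
  set K : Γ → Finset V := fun b => M.comp (Function.update c v b) v with hK
  have hhole : ∀ b, M.Hole t (Function.update c v b) v := fun b => (hole_update b).2 h
  have hvK : ∀ b, v ∈ K b := fun b => self_mem_comp _ _
  have hdeg : ∀ b, M.degIn (K b) v = t := fun b => hM.degIn_comp (hhole b) (hvK b)
  have hblock : ∀ b b', b ≠ b' → (¬ ∃ u, K b = {v, u}) →
      ∃ s, 0 < s ∧ M.Uniform s (K b ∪ K b') := by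
    intro b b' hbb hnp
    have hcb : Function.update c v b v = b := by simp
    rcases hM.uniformBlock_or_pair (hhole b) (b := b') (by rw [hcb]; exact hbb.symm) with
      ⟨s, B, hB, hv⟩ | h'
    · rw [hcb] at hB
      refine ⟨s, hB.pos, hB.uniform.mono (Finset.union_subset ?_ ?_)⟩
      · exact hM.comp_subset_of_uniformBlock (hhole b) hbb (by simp) hB hv
      · refine hM.comp_subset_of_uniformBlock (hhole b') hbb (by simp) (s := s) ?_ hv
        have := union_cls_update (c := Function.update c v b) (v := v) (a := b) (b := b')
          (by simp) (d := b') (by simp)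
        rw [Function.update_idem] at this
        rwa [this]
    · exact absurd h' hnp
  have hKc : K (c v) = M.comp c v := by simp [hK]
  -- `K b` and `K (c v)` lie in a common uniform set and have the same degree t, hence the same
  -- size; so none of them is a pair.
  have hnp : ∀ b, ¬ ∃ u, K b = {v, u} := by
    rintro b ⟨u, hu⟩
    by_cases hb : b = c v
    · subst hb; rw [hKc] at hu; exact hpair ⟨u, hu⟩
    obtain ⟨s, hs, hU⟩ := hblock (c v) b (Ne.symm hb) (by rwa [hKc])
    have h1 := hdeg b
    have h2 := hdeg (c v)
    have hvu : v ≠ u := by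
      rintro rfl
      rw [hu] at h1
      simp [degIn, M.loopless] at h1
      exact hM.pos.ne h1
    rw [(hU.mono Finset.subset_union_right).degIn (hvK b), hu, Finset.card_pair hvu] at h1
    rw [(hU.mono Finset.subset_union_left).degIn (hvK _)] at h2
    have h3 : (K (c v)).card - 1 = 1 := by
      refine Nat.eq_of_mul_eq_mul_left hs ?_
      omega
    have h4 : (K (c v)).card = 2 := by omega
    have h5 : ((K (c v)).erase v).card = 1 := by rw [Finset.card_erase_of_mem (hvK _), h4]
    obtain ⟨w, hw⟩ := Finset.card_eq_one.1 h5
    refine hpair ⟨w, ?_⟩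
    rw [← hKc, ← Finset.insert_erase (hvK (c v)), hw]
  obtain ⟨u, huK, hvu⟩ := exists_adj_of_degIn_pos (M := M) (A := K (c v)) (v := v)
    (by rw [hdeg]; exact hM.pos)
  have hne : v ≠ u := by rintro rfl; exact hvu (M.loopless _)
  set s := M.m v u with hs
  have hvs : ∀ b, ∀ x ∈ K b, x ≠ v → M.m v x = s := by
    have hother : ∃ b', c v ≠ b' := by
      have : Nontrivial Γ := Fintype.one_lt_card_iff_nontrivial.1 hΓ
      obtain ⟨b', hb'⟩ := exists_ne (c v)
      exact ⟨b', hb'.symm⟩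
    intro b x hx hxv
    by_cases hb : c v = b
    · obtain ⟨b', hb'⟩ := hother
      obtain ⟨s', -, hU⟩ := hblock (c v) b' hb' (hnp _)
      have hU := hU.mono Finset.subset_union_left
      rw [hU v (hvK _) x (hb ▸ hx) hxv.symm, hs, hU v (hvK _) u huK hne]
    · obtain ⟨s', -, hU⟩ := hblock (c v) b hb (hnp _)
      rw [hU v (Finset.mem_union_left _ (hvK _)) x (Finset.mem_union_right _ hx) hxv.symm, hs,
        hU v (Finset.mem_union_left _ (hvK _)) u (Finset.mem_union_left _ huK) hne]
  have hU : M.Uniform s (Finset.univ.biUnion K) := by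
    intro x hx y hy hxy
    simp only [Finset.mem_biUnion, Finset.mem_univ, true_and] at hx hy
    obtain ⟨b, hx⟩ := hx
    obtain ⟨b', hy⟩ := hy
    by_cases hxv : x = v
    · subst hxv; exact hvs b' y hy hxy.symm
    obtain ⟨b'', hb'', hy'⟩ : ∃ b'', b ≠ b'' ∧ y ∈ K b ∪ K b'' := by
      by_cases hb : b = b'
      · have : Nontrivial Γ := Fintype.one_lt_card_iff_nontrivial.1 hΓ
        obtain ⟨d, hd⟩ := exists_ne b
        exact ⟨d, hd.symm, Finset.mem_union_left _ (hb ▸ hy)⟩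
      · exact ⟨b', hb, Finset.mem_union_right _ hy⟩
    obtain ⟨s', -, hU⟩ := hblock b b'' hb'' (hnp _)
    rw [hU x (Finset.mem_union_left _ hx) y hy' hxy,
      ← hU v (Finset.mem_union_left _ (hvK _)) x (Finset.mem_union_left _ hx) (Ne.symm hxv)]
    exact hvs b x hx hxv
  have hvU : v ∈ Finset.univ.biUnion K := Finset.mem_biUnion.2 ⟨c v, Finset.mem_univ _, hvK _⟩
  -- Each neighbor of `v` is in the component of `v` for its own color. By uniformity every vertex
  -- of the union then has full degree inside it, so by connectedness the union is everything.
  have hUd : M.degIn (Finset.univ.biUnion K) v = Fintype.card Γ * t := by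
    rw [← hM.reg v]
    refine degIn_congr fun y hy => ⟨fun _ => Finset.mem_univ _, fun _ => ?_⟩
    refine Finset.mem_biUnion.2 ⟨c y, Finset.mem_univ _, ?_⟩
    have hyv : y ≠ v := by rintro rfl; exact hy (M.loopless _)
    exact mem_comp_of_adj (self_mem_comp _ _) (by simp [hyv]) hy
  refine ⟨s, Nat.pos_of_ne_zero hvu, ?_, hU.mono ?_⟩
  · have := (hU.mono (Finset.subset_biUnion_of_mem K (Finset.mem_univ (c v)))).degIn (hvK (c v))
    rw [hdeg] at this
    exact ⟨_, this⟩
  · refine hl.subset_of_closed (Finset.mem_univ v) hvU fun y _ hy z hz hyz => ?_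
    refine mem_of_degIn_le (Finset.subset_univ _) ?_ hz hyz
    rw [hM.reg, hU.degIn hy, ← hU.degIn hvU, hUd]

/-- A linked critical multigraph with at least two colors is uniform, or all its adjacent pairs are
joined by exactly `t` edges. -/
lemma Critical.uniform_or_mult (hΓ : 2 ≤ Fintype.card Γ) (hl : M.Linked Finset.univ) :
    (∃ s, 0 < s ∧ s ∣ t ∧ M.Uniform s Finset.univ) ∨ ∀ x y, M.m x y = 0 ∨ M.m x y = t := by
  by_cases hp : ∃ (c : V → Γ) (v : V), M.Hole t c v ∧ ¬ ∃ u, M.comp c v = {v, u}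
  · obtain ⟨c, v, h, hnp⟩ := hp
    exact .inl (hM.uniform_of_not_pair hΓ hl h hnp)
  push Not at hp
  refine .inr fun x y => ?_
  by_contra! hxy
  have : Nonempty Γ := Fintype.card_pos_iff.1 (by omega)
  obtain ⟨c, hc⟩ := hM.exists_hole hl x
  have hc' := (hole_update (c y)).2 hc
  obtain ⟨u, hu⟩ := hp _ _ hc'
  have hyx : y ≠ x := by rintro rfl; exact hxy.1 (M.loopless _)
  have hy : y ∈ M.comp (Function.update c x (c y)) x :=
    mem_comp_of_adj (self_mem_comp _ _) (by simp [hyx]) hxy.1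
  have hd := hM.degIn_comp hc' (self_mem_comp _ x)
  rw [hu] at hy hd
  have hyu : y = u := by simpa [hyx] using hy
  subst hyu
  rw [degIn, Finset.sum_pair hyx.symm, M.loopless, zero_add] at hd
  exact hxy.2 hd

end

/-! ### Kempe chains when all adjacent pairs are joined by `t` edges -/

/-- Proper coloring outside the vertex `v`. -/
def ProperOff (M : EdgeMult V) (c : V → Γ) (v : V) : Prop :=
  ∀ x y, x ≠ v → y ≠ v → M.m x y ≠ 0 → c x ≠ c y

/-- Being joined by a path with colors `i` and `j` avoiding `v`. -/
def Chain (M : EdgeMult V) (c : V → Γ) (v : V) (i j : Γ) (x y : V) : Prop :=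
  Relation.ReflTransGen (fun x y => (y ≠ v ∧ (c y = i ∨ c y = j)) ∧ M.m x y ≠ 0) x y

lemma ProperOff.hole (h : M.ProperOff c v) (ht : 0 < t) : M.Hole t c v := by
  intro a B hB ⟨x, hx⟩
  refine ⟨x, hx, ?_⟩
  rw [degIn, Finset.sum_eq_zero]
  · exact ht
  · intro y hy
    by_contra hxy
    have h1 := hB hx
    have h2 := hB hy
    rw [Finset.mem_erase, mem_cls] at h1 h2
    exact h x y h1.1 h2.1 hxy (h1.2.trans h2.2.symm)

lemma Chain.color (h : M.Chain c v i j x y) (hx : x ≠ v) (hc : c x = i ∨ c x = j) :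
    y ≠ v ∧ (c y = i ∨ c y = j) := by
  induction h with
  | refl => exact ⟨hx, hc⟩
  | tail _ h _ => exact h.1

lemma Chain.symm (h : M.Chain c v i j x y) (hx : x ≠ v) (hc : c x = i ∨ c x = j) :
    M.Chain c v i j y x := by
  induction h with
  | refl => exact .refl
  | tail h1 h2 ih =>
    exact .head ⟨Chain.color h1 hx hc, by rw [M.symm]; exact h2.2⟩ ih

section
variable (hM : M.Critical Γ t) (hm : ∀ x y, M.m x y = 0 ∨ M.m x y = t)
include hM hm

/-- Two adjacent vertices are joined by t edges, so a pair of the same color away from the hole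
would not be strictly t-degenerate. -/
lemma Critical.properOff (h : M.Hole t c v) : M.ProperOff c v := by
  intro x y hx hy hxy hc
  have hne : x ≠ y := by rintro rfl; exact hxy (M.loopless _)
  have ht := (hm x y).resolve_left hxy
  obtain ⟨z, hz, hlt⟩ := h (c x) {x, y} (by
    intro z hz
    simp only [Finset.mem_insert, Finset.mem_singleton] at hz
    rcases hz with rfl | rfl <;> simp [*]) ⟨x, by simp⟩
  rw [degIn, Finset.sum_pair hne] at hlt
  simp only [Finset.mem_insert, Finset.mem_singleton] at hz
  rcases hz with rfl | rfl
  · omega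
  · rw [M.symm z x] at hlt; omega

lemma Critical.exists_adj (h : M.Hole t c v) (a : Γ) : ∃ u, c u = a ∧ M.m v u ≠ 0 := by
  obtain ⟨u, hu, hvu⟩ := exists_adj_of_degIn_pos (M := M) (A := cls c a) (v := v)
    (by rw [hM.degIn_cls h]; exact hM.pos)
  exact ⟨u, mem_cls.1 hu, hvu⟩

lemma Critical.adj_unique (h : M.Hole t c v) (hu : M.m v u ≠ 0) (hw : M.m v w ≠ 0)
    (hc : c u = c w) : u = w := by
  by_contra hne
  have h1 := hM.degIn_cls h (c u)
  have h2 := (hm v u).resolve_left hu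
  have h3 := (hm v w).resolve_left hw
  rw [← degIn_erase_add (x := u) (by simp)] at h1
  have h4 := m_le_degIn (M := M) (A := (cls c (c u)).erase u) (x := w)
    (Finset.mem_erase.2 ⟨Ne.symm hne, by simp [hc]⟩) v
  have := hM.pos
  omega

/-- Moving the hole along a chain. -/
lemma Critical.exists_hole_of_chain (h : M.Hole t c v) (hij : i ≠ j) (hvu : M.m v u ≠ 0)
    (hu : c u = i ∨ c u = j) (hx : M.Chain c v i j u x) :
    M.degIn (insert v (cls c i ∪ cls c j)) x = 2 * t ∧
    ∀ k, k ≠ i → k ≠ j → M.degIn ((cls c k).erase v) x = t := by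
  have huv : u ≠ v := by rintro rfl; exact hvu (M.loopless _)
  -- Moving the hole one step gives the old hole the color of the new one. Invariant: the vertices
  -- that are the hole or have color `i` or `j` form a fixed set, and other colors are unchanged.
  have key : ∃ c', M.Hole t c' x ∧ (∀ z, (z = x ∨ c' z = i ∨ c' z = j) ↔
      (z = v ∨ c z = i ∨ c z = j)) ∧ ∀ z, ¬ (z = v ∨ c z = i ∨ c z = j) → c' z = c z := by
    have hmove : ∀ x y c', M.Hole t c' x → (∀ z, (z = x ∨ c' z = i ∨ c' z = j) ↔
        (z = v ∨ c z = i ∨ c z = j)) → (∀ z, ¬ (z = v ∨ c z = i ∨ c z = j) → c' z = c z) →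
        (c y = i ∨ c y = j) → M.m x y ≠ 0 → ∃ c', M.Hole t c' y ∧
        (∀ z, (z = y ∨ c' z = i ∨ c' z = j) ↔
        (z = v ∨ c z = i ∨ c z = j)) ∧ ∀ z, ¬ (z = v ∨ c z = i ∨ c z = j) → c' z = c z := by
      intro x y c' h1 h2 h3 hy hxy
      have hyx : y ≠ x := by rintro rfl; exact hxy (M.loopless _)
      have hcy : c' y = i ∨ c' y = j := ((h2 y).2 (.inr hy)).resolve_left hyx
      refine ⟨Function.update c' x (c' y),
        hM.hole_of_adj ((hole_update _).2 h1) (by simp [hyx]) hxy, fun z => ?_, fun z hz => ?_⟩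
      · rw [← h2 z]
        by_cases hzx : z = x
        · subst hzx; simp [hcy]
        · by_cases hzy : z = y
          · subst hzy; simp [hcy]
          · simp [hzx, hzy]
      · have hzx : z ≠ x := by rintro rfl; exact hz ((h2 z).1 (.inl rfl))
        simp [hzx, h3 z hz]
    induction hx with
    | refl => exact hmove v u c h (fun _ => .rfl) (fun _ _ => rfl) hu hvu
    | tail _ h2 ih =>
      obtain ⟨c', e1, e2, e3⟩ := ih
      exact hmove _ _ c' e1 e2 e3 h2.1.2 h2.2
  obtain ⟨c', e1, e2, e3⟩ := key
  constructor
  · rw [two_mul]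
    nth_rewrite 1 [← hM.degIn_cls e1 i]
    rw [← hM.degIn_cls e1 j, ← degIn_union_cls hij]
    refine degIn_congr fun z hz => ?_
    have hzx : z ≠ x := by rintro rfl; exact hz (M.loopless _)
    have := e2 z
    simp only [hzx, false_or] at this
    simp [this]
  · intro k hki hkj
    rw [← hM.degIn_cls e1 k]
    refine degIn_congr fun z hz => ?_
    have hzx : z ≠ x := by rintro rfl; exact hz (M.loopless _)
    have h2 := e2 z
    have h3 := e3 z
    simp only [hzx, false_or] at h2
    rw [Finset.mem_erase, mem_cls, mem_cls]
    constructor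
    · rintro ⟨hzv, rfl⟩
      exact h3 (by simp [hzv, hki, hkj])
    · rintro rfl
      have h4 := mt h2.2 (by simp [hki, hkj])
      exact ⟨fun h => h4 (.inl h), (h3 h4).symm⟩

/-- Two chains from the same neighbor of the hole in different colors only share that neighbor. -/
lemma Critical.eq_of_chain_chain (h : M.Hole t c v) (hij : i ≠ j) (hik : i ≠ k) (hjk : j ≠ k)
    (hvu : M.m v u ≠ 0) (hu : c u = i) (h1 : M.Chain c v i j u x) (h2 : M.Chain c v i k u x) :
    x = u := by
  have huv : u ≠ v := by rintro rfl; exact hvu (M.loopless _)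
  obtain ⟨hxv, hcx⟩ := h1.color huv (.inl hu)
  obtain ⟨-, hcx'⟩ := h2.color huv (.inl hu)
  have hxi : c x = i := by
    rcases hcx with h | h
    · exact h
    · rcases hcx' with h' | h'
      · exact h'
      · exact absurd (h.symm.trans h') hjk
  by_contra hne
  have hxv' : M.m x v = 0 := by
    by_contra h'
    exact hne (hM.adj_unique hm h (by rwa [M.symm]) hvu (hxi.trans hu.symm))
  have e1 := (hM.exists_hole_of_chain hm h hij hvu (.inl hu) h1).1
  have e2 := (hM.exists_hole_of_chain hm h hik hvu (.inl hu) h2).2 j hij.symm hjk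
  -- `x` has color `i` and is not adjacent to `v`, so the first chain forces all its 2t edges to go
  -- to color `j`. The second chain allows only t.
  have e3 : M.degIn (insert v (cls c i ∪ cls c j)) x = M.degIn ((cls c j).erase v) x := by
    refine degIn_congr fun z hz => ?_
    have hzv : z ≠ v := by rintro rfl; exact hz hxv'
    have := hM.properOff hm h x z hxv hzv hz
    rw [hxi] at this
    simp [hzv, this.symm]
  have := hM.pos
  omega

open Classical in
/-- Exchanging the colors `i` and `j` on a chain. -/
noncomputable def kempe (M : EdgeMult V) (c : V → Γ) (v : V) (i j : Γ) (u : V) (x : V) : Γ :=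
  if M.Chain c v i j u x then Equiv.swap i j (c x) else c x

omit hM hm in
lemma ProperOff.kempe (h : M.ProperOff c v) (huv : u ≠ v) (hu : c u = i ∨ c u = j) :
    M.ProperOff (M.kempe c v i j u) v := by
  have key : ∀ x y, x ≠ v → y ≠ v → M.m x y ≠ 0 → M.Chain c v i j u x →
      ¬ M.Chain c v i j u y → Equiv.swap i j (c x) ≠ c y := by
    intro x y hx hy hxy h1 h2 heq
    have h3 : ¬ (c y = i ∨ c y = j) := fun h3 => h2 (Relation.ReflTransGen.tail h1 ⟨⟨hy, h3⟩, hxy⟩)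
    rcases (Chain.color h1 huv hu).2 with h4 | h4 <;> rw [h4] at heq <;> simp at heq <;>
      simp [← heq] at h3
  intro x y hx hy hxy
  unfold EdgeMult.kempe
  split_ifs with h1 h2 h2
  · exact fun h' => h x y hx hy hxy ((Equiv.swap i j).injective h')
  · exact key x y hx hy hxy h1 h2
  · exact (key y x hy hx (by rwa [M.symm]) h2 h1).symm
  · exact h x y hx hy hxy

/-- Otherwise exchanging the colors on the chain of `u` leaves `w` alone, and the hole loses its
only neighbor of color `i`. -/
lemma Critical.chain_of_adj (h : M.Hole t c v) (hij : i ≠ j) (hvu : M.m v u ≠ 0)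
    (hvw : M.m v w ≠ 0) (hu : c u = i) (hw : c w = j) : M.Chain c v i j u w := by
  by_contra hcon
  have huv : u ≠ v := by rintro rfl; exact hvu (M.loopless _)
  have h' := ((hM.properOff hm h).kempe huv (.inl hu) (j := j)).hole hM.pos
  obtain ⟨x, hx, hvx⟩ := hM.exists_adj hm h' i
  unfold EdgeMult.kempe at hx
  split_ifs at hx with h1
  · rcases (Chain.color h1 huv (.inl hu)).2 with h2 | h2
    · rw [h2, Equiv.swap_apply_left] at hx
      exact hij hx.symm
    · exact hcon (hM.adj_unique hm h hvx hvw (h2.trans hw.symm) ▸ h1)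
  · exact h1 (hM.adj_unique hm h hvx hvu (hx.trans hu.symm) ▸ .refl)

/-- The Kempe chain argument for Brooks' theorem: exchange colors on the chain from `u` in its own
and a third color `k`. The old chain from `w` survives up to a neighbor `x` of `u`; now `u` has
color `k`, so `x` lies on two chains from `w` and must equal `w`. -/
lemma Critical.adj_of_adj (hΓ : 3 ≤ Fintype.card Γ) (h : M.Hole t c v) (hvu : M.m v u ≠ 0)
    (hvw : M.m v w ≠ 0) (huw : u ≠ w) : M.m u w ≠ 0 := by
  intro hnadj
  have huv : u ≠ v := by rintro rfl; exact hvu (M.loopless _)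
  have hwv : w ≠ v := by rintro rfl; exact hvw (M.loopless _)
  have hcuw : c u ≠ c w := fun h' => huw (hM.adj_unique hm h hvu hvw h')
  obtain ⟨k, hku, hkw⟩ : ∃ k, k ≠ c u ∧ k ≠ c w := by
    by_contra! hcon
    have : (Finset.univ : Finset Γ) ⊆ {c u, c w} := by
      intro k _
      by_cases hk : k = c u
      · simp [hk]
      · simp [hcon k hk]
    have h1 := Finset.card_le_card this
    rw [Finset.card_pair hcuw, Finset.card_univ] at h1
    omega
  obtain ⟨z, hz, hvz⟩ := hM.exists_adj hm h k
  have hproper := hM.properOff hm h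
  set c' := M.kempe c v (c u) k u with hc'
  have h' : M.Hole t c' v := (hproper.kempe huv (.inl rfl)).hole hM.pos
  have huk := hM.chain_of_adj hm h hku.symm hvu hvz rfl hz
  have hc'u : c' u = k := by simp [hc', kempe, Chain, Relation.ReflTransGen.refl]
  have hstay : ∀ x, x ≠ u → M.Chain c v (c u) (c w) u x → c' x = c x := by
    intro x hxu hx
    rw [hc', kempe, if_neg]
    exact fun hx' => hxu (hM.eq_of_chain_chain hm h hcuw hku.symm hkw.symm hvu rfl hx hx')
  have hchain := hM.chain_of_adj hm h hcuw hvu hvw rfl rfl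
  have hc'w : c' w = c w := hstay w huw.symm hchain
  -- the last vertex before `u` on the chain from `w` to `u`
  obtain ⟨x, hxw, hxu⟩ : ∃ x, (M.Chain c v (c u) (c w) u x ∧ x ≠ u ∧
      M.Chain c' v (c w) (c u) w x) ∧ M.m x u ≠ 0 := by
    have hback := hchain.symm huv (.inl rfl)
    by_contra! hcon
    have : ∀ x, M.Chain c v (c u) (c w) w x →
        M.Chain c v (c u) (c w) u x ∧ x ≠ u ∧ M.Chain c' v (c w) (c u) w x := by
      intro x hx
      induction hx with
      | refl => exact ⟨hchain, huw.symm, .refl⟩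
      | @tail y z h1 h2 ih =>
        have hne : z ≠ u := fun heq => h2.2 (heq ▸ hcon y ih)
        have hch := Relation.ReflTransGen.tail ih.1 h2
        refine ⟨hch, hne, Relation.ReflTransGen.tail ih.2.2 ⟨⟨h2.1.1, ?_⟩, h2.2⟩⟩
        rw [hstay _ hne hch]
        exact h2.1.2.symm
    exact (this u hback).2.1 rfl
  have hxv := (Chain.color hxw.1 huv (.inl rfl)).1
  have hcx : c x = c w :=
    (Chain.color hxw.1 huv (.inl rfl)).2.resolve_left (hproper x u hxv huv hxu)
  have hc'x : c' x = c w := (hstay x hxw.2.1 hxw.1).trans hcx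
  have hwx : M.Chain c' v (c w) k w x :=
    Relation.ReflTransGen.tail (hM.chain_of_adj hm h' hkw.symm hvw hvu hc'w hc'u)
      ⟨⟨hxv, .inl hc'x⟩, by rwa [M.symm]⟩
  have := hM.eq_of_chain_chain hm h' hcuw.symm hkw.symm hku.symm hvw hc'w hxw.2.2 hwx
  rw [this, M.symm] at hxu
  exact hxu hnadj

/-- Brooks' theorem for multigraphs all of whose adjacent pairs are joined by `t` edges. -/
lemma Critical.uniform_of_three_le (hΓ : 3 ≤ Fintype.card Γ) (hl : M.Linked Finset.univ) :
    M.Uniform t Finset.univ := by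
  have : Nonempty Γ := Fintype.card_pos_iff.1 (by omega)
  have htrans : ∀ v u w, M.m v u ≠ 0 → M.m v w ≠ 0 → u ≠ w → M.m u w ≠ 0 := by
    intro v u w hu hw huw
    obtain ⟨c, hc⟩ := hM.exists_hole hl v
    exact hM.adj_of_adj hm hΓ hc hu hw huw
  intro x _ y _ hxy
  have h1 : (Finset.univ : Finset V) ⊆ Finset.univ.filter fun z => z = x ∨ M.m x z ≠ 0 := by
    refine hl.subset_of_closed (Finset.mem_univ x) (by simp) fun z _ hz w _ hzw => ?_
    simp only [Finset.mem_filter, Finset.mem_univ, true_and] at hz ⊢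
    rcases hz with rfl | hz
    · exact .inr hzw
    · by_cases hwx : w = x
      · exact .inl hwx
      · exact .inr (htrans z x w (by rwa [M.symm]) hzw (Ne.symm hwx))
  have h2 := h1 (Finset.mem_univ y)
  simp only [Finset.mem_filter, Finset.mem_univ, true_and] at h2
  exact (hm x y).resolve_left (h2.resolve_left hxy.symm)

end

end EdgeMult

/-! ### Two colors, and the theorem for edge multiplicities -/

namespace EdgeMult

variable {V Γ : Type*} [Fintype V] [DecidableEq V] [Fintype Γ] [DecidableEq Γ]
  {M : EdgeMult V} {t : ℕ} {v : V}

/-- The simple graph of adjacent pairs. -/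
def simple (M : EdgeMult V) : SimpleGraph V where
  Adj x y := M.m x y ≠ 0
  symm := ⟨fun x y h => by rwa [M.symm]⟩
  loopless := ⟨fun x h => h (M.loopless x)⟩

lemma simple_connected (hl : M.Linked Finset.univ) : M.simple.Connected := by
  classical
  obtain ⟨⟨v, -⟩, -⟩ := id hl
  have : Nonempty V := ⟨v⟩
  refine SimpleGraph.Connected.mk fun x y => ?_
  have : (Finset.univ : Finset V) ⊆ Finset.univ.filter fun z => M.simple.Reachable x z := by
    refine hl.subset_of_closed (Finset.mem_univ x) (by simp) fun z _ hz w _ hzw => ?_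
    simp only [Finset.mem_filter, Finset.mem_univ, true_and] at hz ⊢
    exact hz.trans (SimpleGraph.Adj.reachable hzw)
  simpa using this (Finset.mem_univ y)

/-- A linked critical multigraph with two colors whose adjacent pairs are joined by `t` edges is an
odd cycle with all edges replaced by `t` parallel edges. -/
lemma Critical.exists_cycle (hM : M.Critical Γ t) (hm : ∀ x y, M.m x y = 0 ∨ M.m x y = t)
    (hΓ : Fintype.card Γ = 2) (hl : M.Linked Finset.univ) :
    ∃ n, 3 ≤ n ∧ Odd n ∧ ∃ f : V ≃ Fin n, ∀ x y,
      M.m x y = if (SimpleGraph.cycleGraph n).Adj (f x) (f y) then t else 0 := by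
  classical
  have hconn := simple_connected hl
  have hdeg : ∀ v, M.simple.degree v = 2 := by
    intro v
    have h1 : M.degIn Finset.univ v = M.simple.degree v * t := by
      rw [degIn, ← Finset.sum_subset (Finset.subset_univ (M.simple.neighborFinset v)),
        Finset.sum_congr rfl (g := fun _ => t)]
      · simp
      · intro x hx
        rw [SimpleGraph.mem_neighborFinset] at hx
        exact (hm v x).resolve_left hx
      · intro x _ hx
        rw [SimpleGraph.mem_neighborFinset] at hx
        exact not_not.1 hx
    rw [hM.reg, hΓ] at h1
    exact (Nat.eq_of_mul_eq_mul_right hM.pos h1).symm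
  -- A non-trivial finite tree has a leaf, but all degrees are 2.
  have hcyc : ¬ M.simple.IsAcyclic := by
    intro hac
    have hnt : Nontrivial V := by
      obtain ⟨⟨v, -⟩, -⟩ := id hl
      have : 0 < M.simple.degree v := by rw [hdeg]; norm_num
      obtain ⟨w, hw⟩ := (M.simple.degree_pos_iff_exists_adj v).1 this
      exact ⟨v, w, hw.ne⟩
    obtain ⟨v, hv⟩ :=
      SimpleGraph.IsTree.exists_vert_degree_one_of_nontrivial (G := M.simple) ⟨hconn, hac⟩
    rw [hdeg] at hv
    omega
  rw [SimpleGraph.isAcyclic_iff_free_cycleGraph] at hcyc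
  push Not at hcyc
  obtain ⟨n, hn, hfree⟩ := hcyc
  obtain ⟨⟨φ, hφ⟩⟩ : (SimpleGraph.cycleGraph n).IsContained M.simple := hfree
  change Function.Injective φ at hφ
  -- The two cycle neighbors already account for all 2t edges, so the cycle is closed under
  -- adjacency and spans by connectedness.
  have hnbr : ∀ i y, M.m (φ i) y ≠ 0 → ∃ j, (SimpleGraph.cycleGraph n).Adj i j ∧ φ j = y := by
    intro i y hy
    have hcard : ((SimpleGraph.cycleGraph n).neighborFinset i).card = 2 := by
      obtain ⟨k, rfl⟩ : ∃ k, n = k + 3 := ⟨n - 3, by omega⟩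
      rw [SimpleGraph.card_neighborFinset_eq_degree]
      convert SimpleGraph.cycleGraph_degree_three_le (n := k) (v := i)
    have h1 : y ∈ ((SimpleGraph.cycleGraph n).neighborFinset i).image φ := by
      refine mem_of_degIn_le (M := M) (v := φ i) (Finset.subset_univ _) ?_ (Finset.mem_univ y) hy
      rw [hM.reg, hΓ, degIn, Finset.sum_image (fun _ _ _ _ h => hφ h),
        Finset.sum_congr rfl (g := fun _ => t)]
      · simp only [Finset.sum_const, hcard, smul_eq_mul]; exact le_rfl
      · intro j hj
        rw [SimpleGraph.mem_neighborFinset] at hj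
        exact (hm _ _).resolve_left (φ.map_adj hj)
    obtain ⟨j, hj, hjy⟩ := Finset.mem_image.1 h1
    exact ⟨j, by simpa using hj, hjy⟩
  have hsurj : Function.Surjective φ := by
    have : (Finset.univ : Finset V) ⊆ Finset.univ.image φ := by
      refine hl.subset_of_closed (x := φ ⟨0, by omega⟩) (Finset.mem_univ _) (by simp) ?_
      intro y _ hy z _ hyz
      obtain ⟨i, -, rfl⟩ := Finset.mem_image.1 hy
      obtain ⟨j, -, hj⟩ := hnbr i z hyz
      exact Finset.mem_image.2 ⟨j, Finset.mem_univ _, hj⟩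
    intro y
    obtain ⟨i, -, hi⟩ := Finset.mem_image.1 (this (Finset.mem_univ y))
    exact ⟨i, hi⟩
  let f : V ≃ Fin n := (Equiv.ofBijective φ ⟨hφ, hsurj⟩).symm
  have hf : ∀ x, φ (f x) = x := fun x => (Equiv.ofBijective φ ⟨hφ, hsurj⟩).apply_symm_apply x
  have hadj : ∀ x y, M.m x y ≠ 0 ↔ (SimpleGraph.cycleGraph n).Adj (f x) (f y) := by
    intro x y
    constructor
    · intro h
      obtain ⟨j, hj, hjy⟩ := hnbr (f x) y (by rwa [hf])
      rwa [hφ (hjy.trans (hf y).symm)] at hj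
    · intro h
      have := φ.map_adj h
      rwa [hf, hf] at this
  refine ⟨n, hn, ?_, f, fun x y => ?_⟩
  · by_contra hodd
    rw [Nat.not_odd_iff_even] at hodd
    let C := SimpleGraph.cycleGraph.bicoloring_of_even n hodd
    let e : Bool ≃ Γ := Fintype.equivOfCardEq (by simp [hΓ])
    refine hM.not_good (fun x => e (C (f x))) fun a B hB ⟨x, hx⟩ => ⟨x, hx, ?_⟩
    rw [degIn, Finset.sum_eq_zero]
    · exact hM.pos
    · intro y hy
      by_contra hxy
      have h1 := hB hx
      have h2 := hB hy
      rw [mem_cls] at h1 h2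
      exact C.valid ((hadj x y).1 hxy) (e.injective (h1.trans h2.symm))
  · split_ifs with h
    · exact (hm x y).resolve_left ((hadj x y).2 h)
    · exact not_not.1 (mt (hadj x y).1 h)

/-- A linked multigraph that is not regular of degree `r`, the largest degree allowed, is strictly
`r`-degenerate. -/
lemma sparse_univ_of_lt {r : ℕ} (hl : M.Linked Finset.univ)
    (hle : ∀ x, M.degIn Finset.univ x ≤ r) (hv : M.degIn Finset.univ v < r) :
    M.Sparse r Finset.univ := by
  intro B _ hn
  by_cases hB : B = Finset.univ
  · exact ⟨v, hB ▸ Finset.mem_univ v, hB ▸ hv⟩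
  · obtain ⟨x, hx, y, -, hy, hxy⟩ := hl.2 B (Finset.subset_univ _) hn hB
    refine ⟨x, hx, ?_⟩
    have h1 := degIn_mono (M := M) (Finset.subset_univ (insert y B)) x
    rw [degIn_insert hy] at h1
    have := hle x
    omega

/-- The Brooks-type theorem for edge multiplicities. -/
theorem exists_good_or (ht : 0 < t) (hl : M.Linked Finset.univ) {k : ℕ} (hk : 2 ≤ k)
    (hle : ∀ x, M.degIn Finset.univ x ≤ k * t) :
    (∃ c : V → Fin k, M.Good t c) ∨
    (∃ s, 0 < s ∧ s ∣ t ∧ M.Uniform s Finset.univ ∧ s * (Fintype.card V - 1) = k * t) ∨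
    (k = 2 ∧ ∃ n, 3 ≤ n ∧ Odd n ∧ ∃ f : V ≃ Fin n, ∀ x y,
      M.m x y = if (SimpleGraph.cycleGraph n).Adj (f x) (f y) then t else 0) := by
  by_cases hgood : ∃ c : V → Fin k, M.Good t c
  · exact .inl hgood
  right
  have : Nonempty (Fin k) := ⟨⟨0, by omega⟩⟩
  have hM : M.Critical (Fin k) t := by
    refine ⟨ht, fun v => ?_, fun c hc => hgood ⟨c, hc⟩⟩
    rw [Fintype.card_fin]
    refine (hle v).antisymm ?_
    by_contra! hlt
    exact hgood (exists_good_of_sparse (by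
      rw [Fintype.card_fin]; exact sparse_univ_of_lt hl hle hlt))
  obtain ⟨v, -⟩ := hl.1
  have hcard : ∀ s, M.Uniform s Finset.univ → s * (Fintype.card V - 1) = k * t := by
    intro s hU
    rw [← Finset.card_univ, ← hU.degIn (Finset.mem_univ v), hM.reg, Fintype.card_fin]
  rcases hM.uniform_or_mult (by simpa using hk) hl with ⟨s, hs, hst, hU⟩ | hm
  · exact .inl ⟨s, hs, hst, hU, hcard s hU⟩
  rcases hk.lt_or_eq with hk | rfl
  · have hU := hM.uniform_of_three_le hm (by simpa using Nat.succ_le_of_lt hk) hl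
    exact .inl ⟨t, ht, dvd_rfl, hU, hcard t hU⟩
  · exact .inr ⟨rfl, hM.exists_cycle hm (by simp) hl⟩

end EdgeMult

/-! ### Translation between multigraphs and edge multiplicities -/

namespace Graph

variable {α β α' β' : Type*}

lemma finite_setOf_isLink {G : Graph α β} (hE : E(G).Finite) (x y : α) :
    {e | G.IsLink e x y}.Finite := hE.subset fun _ h => IsLink.edge_mem h

/-! ### Isomorphism and multiplicities -/

lemma exists_ends (G : Graph α β) :
    ∃ ends : E(G) → Sym2 V(G), ∀ (e : E(G)) (x y : V(G)), G.IsLink e x y ↔ ends e = s(x, y) := by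
  have : ∀ e : E(G), ∃ z : Sym2 V(G), ∀ x y : V(G), G.IsLink e x y ↔ z = s(x, y) := by
    rintro ⟨e, he⟩
    obtain ⟨x, y, h⟩ := exists_isLink_of_mem_edgeSet he
    refine ⟨s(⟨x, h.left_mem⟩, ⟨y, h.right_mem⟩), fun x' y' => ?_⟩
    rw [h.isLink_iff_sym2_eq, Sym2.eq_iff, Sym2.eq_iff]
    simp [Subtype.ext_iff]
  choose ends h using this
  exact ⟨ends, h⟩

lemma ncard_setOf_isLink {G : Graph α β} {ends : E(G) → Sym2 V(G)}
    (h : ∀ (e : E(G)) (x y : V(G)), G.IsLink e x y ↔ ends e = s(x, y)) (x y : V(G)) :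
    Nat.card {e : E(G) // ends e = s(x, y)} = {e | G.IsLink e x y}.ncard := by
  rw [← Nat.card_coe_set_eq]
  exact Nat.card_congr
    { toFun := fun e => ⟨e.1, (h _ _ _).2 e.2⟩
      invFun := fun e => ⟨⟨e.1, IsLink.edge_mem e.2⟩, (h ⟨e.1, _⟩ _ _).1 e.2⟩
      left_inv := fun _ => rfl
      right_inv := fun _ => rfl }

/-- The edge bijection is assembled from bijections between the fibers over unordered pairs of ends.
-/
lemma isIsomorphic_of_ncard_eq {G : Graph α β} {H : Graph α' β'} (hG : E(G).Finite)
    (hH : E(H).Finite) (f : V(G) ≃ V(H))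
    (h : ∀ x y : V(G), {e | G.IsLink e x y}.ncard = {e | H.IsLink e (f x) (f y)}.ncard) :
    G.IsIsomorphic H := by
  obtain ⟨ends, hends⟩ := G.exists_ends
  obtain ⟨ends', hends'⟩ := H.exists_ends
  have : Finite E(G) := hG
  have : Finite E(H) := hH
  have hinj := Sym2.map.injective f.injective
  have hfib : ∀ z, Nat.card {e : E(G) // Sym2.map f (ends e) = z} =
      Nat.card {e : E(H) // ends' e = z} := by
    intro z
    obtain ⟨z, rfl⟩ : ∃ z', Sym2.map f z' = z :=
      ⟨Sym2.map f.symm z, by rw [Sym2.map_map]; simp⟩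
    induction z with | _ x y
    simp only [hinj.eq_iff]
    rw [ncard_setOf_isLink hends, Sym2.map_mk, ncard_setOf_isLink hends', h]
  have ψ : ∀ z, {e : E(G) // Sym2.map f (ends e) = z} ≃ {e : E(H) // ends' e = z} :=
    fun z => Classical.choice (Finite.card_eq.1 (hfib z))
  refine ⟨f, Equiv.ofFiberEquiv (f := fun e => Sym2.map f (ends e)) (g := ends') ψ,
    fun e x y => ?_⟩
  have hmap := Equiv.ofFiberEquiv_map (f := fun e => Sym2.map f (ends e)) (g := ends') ψ e
  rw [hends, hends', hmap, ← Sym2.map_mk]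
  exact hinj.eq_iff.symm

lemma IsIsomorphic.ncard_eq {G : Graph α β} {H : Graph α' β'} (h : G.IsIsomorphic H) :
    ∃ f : V(G) ≃ V(H), ∀ x y : V(G),
      {e | G.IsLink e x y}.ncard = {e | H.IsLink e (f x) (f y)}.ncard := by
  obtain ⟨f, g, h⟩ := h
  refine ⟨f, fun x y => ?_⟩
  rw [← Nat.card_coe_set_eq, ← Nat.card_coe_set_eq]
  exact Nat.card_congr
    { toFun := fun e => ⟨g ⟨e.1, IsLink.edge_mem e.2⟩, (h _ _ _).1 e.2⟩
      invFun := fun e => ⟨g.symm ⟨e.1, IsLink.edge_mem e.2⟩, (h _ _ _).2 (by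
        rw [Equiv.apply_symm_apply]; exact e.2)⟩
      left_inv := fun e => by simp
      right_inv := fun e => by simp }

lemma ncard_isLink_inflation {n : ℕ} (s : ℕ) (S : SimpleGraph (Fin n)) [DecidableRel S.Adj]
    (x y : Fin n) :
    {e | (inflation s (ofSimpleGraph S)).IsLink e x y}.ncard = if S.Adj x y then s else 0 := by
  have : {e | (inflation s (ofSimpleGraph S)).IsLink e x y} =
      {e : Sym2 (Fin n) × Fin s | e.1 = s(x, y) ∧ S.Adj x y} := by
    ext ⟨z, i⟩
    change (ofSimpleGraph S).IsLink z x y ↔ _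
    rw [ofSimpleGraph_isLink]
    constructor
    · rintro ⟨rfl, h⟩; exact ⟨rfl, h⟩
    · rintro ⟨h1, h2⟩
      dsimp only at h1
      subst h1; exact ⟨rfl, h2⟩
  rw [this]
  split_ifs with h
  · have h2 : {e : Sym2 (Fin n) × Fin s | e.1 = s(x, y) ∧ S.Adj x y} =
        Set.range fun i : Fin s => (s(x, y), i) := by
      ext ⟨z, i⟩
      simp [h, eq_comm]
    rw [h2, ← Nat.card_coe_set_eq,
      Nat.card_range_of_injective (fun i j h => (Prod.ext_iff.1 h).2), Nat.card_fin]
  · simp [h]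

lemma isIsomorphic_inflation_iff {G : Graph α β} (hE : E(G).Finite) {n : ℕ} (s : ℕ)
    (S : SimpleGraph (Fin n)) [DecidableRel S.Adj] :
    G.IsIsomorphic (inflation s (ofSimpleGraph S)) ↔ ∃ f : V(G) ≃ Fin n, ∀ x y : V(G),
      {e | G.IsLink e x y}.ncard = if S.Adj (f x) (f y) then s else 0 := by
  constructor
  · intro h
    obtain ⟨f, hf⟩ := h.ncard_eq
    refine ⟨f.trans (Equiv.Set.univ (Fin n)), fun x y => ?_⟩
    rw [hf, ncard_isLink_inflation]
    rfl
  · rintro ⟨f, hf⟩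
    refine isIsomorphic_of_ncard_eq hE (Set.toFinite _) (f.trans (Equiv.Set.univ (Fin n)).symm)
      fun x y => ?_
    rw [hf, ← ncard_isLink_inflation]
    rfl

/-! ### Multiplicities of a loopless multigraph -/

/-- The edge multiplicities of a loopless multigraph. -/
noncomputable def edgeMult (G : Graph α β) [G.Loopless] : EdgeMult V(G) where
  m x y := {e | G.IsLink e x y}.ncard
  symm x y := by simp only [isLink_comm]
  loopless x := by
    have : {e | G.IsLink e x x} = ∅ := Set.eq_empty_of_forall_notMem fun e h => h.ne rfl
    rw [this, Set.ncard_empty]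

variable {G : Graph α β} [G.Loopless] [Fintype V(G)] [DecidableEq V(G)] {t : ℕ}

lemma edgeMult_ne_zero (hE : E(G).Finite) {x y : V(G)} :
    G.edgeMult.m x y ≠ 0 ↔ G.Adj x y := by
  change Set.ncard _ ≠ 0 ↔ _
  rw [← Nat.pos_iff_ne_zero, Set.ncard_pos (finite_setOf_isLink hE _ _)]
  rfl

lemma degree_induce (hE : E(G).Finite) {B : Finset V(G)} {v : V(G)} (hv : v ∈ B) :
    (G.induce (Subtype.val '' (B : Set V(G)))).degree v = G.edgeMult.degIn B v := by
  classical
  have h1 : (G.induce (Subtype.val '' (B : Set V(G)))).incidenceSet v =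
      ((B.biUnion fun x => (finite_setOf_isLink hE v x).toFinset : Finset β) : Set β) := by
    ext e
    simp only [mem_incidenceSet, Inc, induce_isLink, Finset.coe_biUnion, Set.mem_iUnion,
      Set.Finite.coe_toFinset]
    constructor
    · rintro ⟨y, h, -, ⟨y', hy, rfl⟩⟩
      exact ⟨y', hy, h⟩
    · rintro ⟨y, hy, h⟩
      exact ⟨y, h, ⟨v, hv, rfl⟩, ⟨y, hy, rfl⟩⟩
  rw [degree, h1, Set.ncard_coe_finset, Finset.card_biUnion]
  · refine Finset.sum_congr rfl fun x _ => ?_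
    exact (Set.ncard_eq_toFinset_card _ _).symm
  · intro x _ y _ hxy
    refine Finset.disjoint_left.2 fun e he he' => ?_
    rw [Set.Finite.mem_toFinset] at he he'
    exact hxy (Subtype.ext (IsLink.right_unique he he'))

lemma degree_eq_degIn (hE : E(G).Finite) (v : V(G)) :
    G.degree v = G.edgeMult.degIn Finset.univ v := by
  rw [← degree_induce hE (Finset.mem_univ v)]
  simp

/-- Induced subgraphs suffice, because adding the missing edges on the same vertices only raises
degrees. -/
lemma isStrictlyDegenerate_iff (hE : E(G).Finite) (A : Finset V(G)) :
    (G.induce (Subtype.val '' (A : Set V(G)))).IsStrictlyDegenerate t ↔ G.edgeMult.Sparse t A := by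
  classical
  constructor
  · intro h B hB ⟨x, hx⟩
    obtain ⟨v, ⟨w, hw, rfl⟩, hlt⟩ := h (G.induce (Subtype.val '' (B : Set V(G)))) (by
      refine ⟨Set.image_mono hB, fun e x y he => ?_⟩
      rw [induce_isLink] at he ⊢
      exact ⟨he.1, Set.image_mono hB he.2.1, Set.image_mono hB he.2.2⟩) ⟨x, x, hx, rfl⟩
    exact ⟨w, hw, by rwa [← degree_induce hE hw]⟩
  · intro h H hH ⟨x, hx⟩
    have hsub : V(H) ⊆ Subtype.val '' (A : Set V(G)) := hH.1
    obtain ⟨x', hx', rfl⟩ := hsub hx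
    obtain ⟨v, hv, hlt⟩ := h (Finset.univ.filter fun z : V(G) => (z : α) ∈ V(H))
      (fun z hz => by
        obtain ⟨z', hz', hzz⟩ := hsub (Finset.mem_filter.1 hz).2
        rwa [← Subtype.ext hzz]) ⟨x', by simpa using hx⟩
    refine ⟨v, (Finset.mem_filter.1 hv).2, lt_of_le_of_lt ?_ hlt⟩
    rw [← degree_induce hE hv]
    refine Set.ncard_le_ncard ?_ (hE.subset ?_)
    · rintro e ⟨y, hy⟩
      have h1 := hH.2 hy
      rw [induce_isLink] at h1
      refine ⟨y, ?_⟩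
      rw [induce_isLink]
      exact ⟨h1.1, ⟨v, by simpa using hv, rfl⟩, ⟨⟨y, h1.1.right_mem⟩, by simpa using hy.right_mem,
        rfl⟩⟩
    · rintro e ⟨y, hy⟩
      rw [induce_isLink] at hy
      exact hy.1.edge_mem

lemma isSDColoring_iff {k : ℕ} (hE : E(G).Finite) (c : V(G) → Fin k) :
    G.IsSDColoring t c ↔ G.edgeMult.Good t c := by
  refine forall_congr' fun a => ?_
  rw [← isStrictlyDegenerate_iff hE]
  have : (c ⁻¹' {a}) = (EdgeMult.cls c a : Set V(G)) := by ext; simp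
  rw [this]

lemma pointPartitionNumber_le_iff (hE : E(G).Finite) (ht : 0 < t) {k : ℕ} :
    G.pointPartitionNumber t ≤ k ↔ ∃ c : V(G) → Fin k, G.edgeMult.Good t c := by
  simp only [pointPartitionNumber, isSDColoring_iff hE]
  constructor
  · intro h
    -- The infimum of the empty set would be 0, so some coloring must be exhibited: all vertices get
    -- different colors.
    have hne : {k : ℕ | ∃ c : V(G) → Fin k, G.edgeMult.Good t c}.Nonempty := by
      refine ⟨_, Fintype.equivFin V(G), fun a B hB ⟨x, hx⟩ => ⟨x, hx, ?_⟩⟩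
      rw [EdgeMult.degIn, Finset.sum_eq_zero]
      · exact ht
      · intro y hy
        have h1 := EdgeMult.mem_cls.1 (hB hx)
        have h2 := EdgeMult.mem_cls.1 (hB hy)
        rw [(Fintype.equivFin V(G)).injective (h1.trans h2.symm), EdgeMult.loopless]
    obtain ⟨c, hc⟩ := Nat.sInf_mem hne
    refine ⟨fun x => Fin.castLE h (c x), fun a B hB ⟨x, hx⟩ => ?_⟩
    refine hc (c x) B (fun y hy => ?_) ⟨x, hx⟩
    have h1 := EdgeMult.mem_cls.1 (hB hx)
    have h2 := EdgeMult.mem_cls.1 (hB hy)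
    exact EdgeMult.mem_cls.2 (Fin.castLE_injective h (h2.trans h1.symm))
  · exact fun h => Nat.sInf_le h

lemma Connected.linked (hG : G.Connected) (hE : E(G).Finite) :
    G.edgeMult.Linked Finset.univ := by
  obtain ⟨⟨v, hv⟩, hconn⟩ := hG
  refine ⟨⟨⟨v, hv⟩, Finset.mem_univ _⟩, fun B _ ⟨x, hx⟩ hne => ?_⟩
  by_contra! hcon
  refine hne (Finset.eq_univ_iff_forall.2 fun y => ?_)
  have key : ∀ z : α, Relation.ReflTransGen G.Adj x z → ∃ hz : z ∈ V(G), ⟨z, hz⟩ ∈ B := by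
    intro z hz
    induction hz with
    | refl => exact ⟨x.2, hx⟩
    | @tail z w _ h ih =>
      obtain ⟨hz, hzB⟩ := ih
      refine ⟨h.right_mem, ?_⟩
      by_contra hw
      exact (edgeMult_ne_zero hE).2 h (hcon ⟨z, hz⟩ hzB ⟨w, h.right_mem⟩ (Finset.mem_univ _) hw)
  exact (key y (hconn x x.2 y y.2)).2

lemma degree_le_maxDegree (v : V(G)) : G.degree v ≤ G.maxDegree :=
  le_csSup ((Set.toFinite V(G)).image _).bddAbove ⟨v, v.2, rfl⟩

lemma maxDegree_of_forall (hne : V(G).Nonempty) {d : ℕ} (h : ∀ v : V(G), G.degree v = d) :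
    G.maxDegree = d := by
  have : G.degree '' V(G) = {d} := by
    ext n
    constructor
    · rintro ⟨v, hv, rfl⟩
      exact h ⟨v, hv⟩
    · rintro rfl
      obtain ⟨v, hv⟩ := hne
      exact ⟨v, hv, h ⟨v, hv⟩⟩
  rw [maxDegree, this, csSup_singleton]

end Graph

/-! ### Lower bounds and degrees in the exceptional cases -/

namespace EdgeMult

variable {V Γ : Type*} [Fintype V] [DecidableEq V] [Fintype Γ] [DecidableEq Γ]
  {M : EdgeMult V} {t s : ℕ}

/-- A class of r ≥ 1 vertices is s(r - 1)-regular, so goodness gives r ≤ t/s; p classes cover at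
most (t/s)p vertices, one too few. -/
lemma Uniform.card_lt_of_good {p : ℕ} (hU : M.Uniform s Finset.univ) (hs : 0 < s) (ht : 0 < t)
    (hst : s ∣ t) (hV : Fintype.card V = t / s * p + 1) {c : V → Γ} (hc : M.Good t c) :
    p < Fintype.card Γ := by
  obtain ⟨q, rfl⟩ := hst
  rw [Nat.mul_div_cancel_left q hs] at hV
  have hq : 0 < q := Nat.pos_of_mul_pos_left ht
  have hcls : ∀ a, (cls c a).card ≤ q := by
    intro a
    rcases (cls c a).eq_empty_or_nonempty with h | h
    · simp [h]
    obtain ⟨v, hv, hlt⟩ := hc a _ subset_rfl h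
    rw [(hU.mono (Finset.subset_univ _)).degIn hv] at hlt
    have := Nat.lt_of_mul_lt_mul_left hlt
    omega
  have hsum : Fintype.card V = ∑ a, (cls c a).card := by
    rw [← Finset.card_univ, Finset.card_eq_sum_card_fiberwise (f := c) (t := Finset.univ) (by simp)]
    rfl
  have hle : ∑ a, (cls c a).card ≤ ∑ _a : Γ, q := Finset.sum_le_sum fun a _ => hcls a
  rw [← hsum, hV] at hle
  simp only [Finset.sum_const, Finset.card_univ, smul_eq_mul] at hle
  by_contra! hcon
  have := Nat.mul_le_mul_left q hcon
  rw [Nat.mul_comm _ q] at hle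
  omega

/-- Adjacent vertices are joined by t edges, so a good 2-coloring would be a proper 2-coloring of an
odd cycle. -/
lemma not_good_of_odd_cycle {n : ℕ} (hn : 2 ≤ n) (hodd : Odd n) (f : V ≃ Fin n)
    (hf : ∀ x y, M.m x y = if (SimpleGraph.cycleGraph n).Adj (f x) (f y) then t else 0)
    (c : V → Fin 2) : ¬ M.Good t c := by
  intro hc
  have hcol : (SimpleGraph.cycleGraph n).Colorable 2 := by
    refine ⟨SimpleGraph.Coloring.mk (fun i => c (f.symm i)) fun {i j} hij heq => ?_⟩
    have hm : M.m (f.symm i) (f.symm j) = t := by rw [hf]; simp [hij]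
    have hm' : M.m (f.symm j) (f.symm i) = t := by rw [M.symm, hm]
    have hne : f.symm i ≠ f.symm j := fun h => hij.ne (f.symm.injective h)
    obtain ⟨z, hz, hlt⟩ := hc (c (f.symm i)) {f.symm i, f.symm j} (by
      intro z hz
      simp only [Finset.mem_insert, Finset.mem_singleton] at hz
      rcases hz with rfl | rfl <;> simp [heq]) ⟨f.symm i, by simp⟩
    rw [degIn, Finset.sum_pair hne] at hlt
    simp only [Finset.mem_insert, Finset.mem_singleton] at hz
    rcases hz with rfl | rfl <;> omega
  have h3 := SimpleGraph.chromaticNumber_cycleGraph_of_odd n hn hodd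
  have := hcol.chromaticNumber_le
  rw [h3] at this
  exact absurd this (by decide)

lemma not_good_of_regular [Nonempty V] (h : ∀ v, M.degIn Finset.univ v = t) (c : V → Fin 1) :
    ¬ M.Good t c := by
  intro hc
  have h1 : cls c 0 = Finset.univ := by ext x; simp [Subsingleton.elim (c x) 0]
  obtain ⟨v, -, hv⟩ := hc 0 Finset.univ h1.ge Finset.univ_nonempty
  rw [h] at hv
  exact lt_irrefl _ hv

lemma degIn_univ_of_cycle {n : ℕ} (hn : 3 ≤ n) (f : V ≃ Fin n)
    (hf : ∀ x y, M.m x y = if (SimpleGraph.cycleGraph n).Adj (f x) (f y) then t else 0) (v : V) :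
    M.degIn Finset.univ v = 2 * t := by
  obtain ⟨k, rfl⟩ : ∃ k, n = k + 3 := ⟨n - 3, by omega⟩
  simp only [degIn, hf]
  rw [Equiv.sum_comp f (fun i => if (SimpleGraph.cycleGraph (k + 3)).Adj (f v) i then t else 0),
    ← Finset.sum_filter, Finset.sum_const, smul_eq_mul]
  congr 1
  rw [← SimpleGraph.cycleGraph_degree_three_le (n := k) (v := f v),
    ← SimpleGraph.card_neighborFinset_eq_degree, SimpleGraph.neighborFinset_eq_filter]

end EdgeMult

/-! ### The exceptional graphs in terms of multiplicities -/

namespace Graph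

variable {α β : Type*} {G : Graph α β} [G.Loopless] [Fintype V(G)] [DecidableEq V(G)] {t : ℕ}

lemma isIsomorphic_inflation_complete_iff (hE : E(G).Finite) {s n : ℕ} :
    G.IsIsomorphic (inflation s (complete n)) ↔
      G.edgeMult.Uniform s Finset.univ ∧ Fintype.card V(G) = n := by
  classical
  rw [complete, isIsomorphic_inflation_iff hE]
  constructor
  · rintro ⟨f, hf⟩
    refine ⟨fun x _ y _ hxy => (hf x y).trans ?_, by simpa using Fintype.card_congr f⟩
    rw [if_pos]
    exact fun h => hxy (f.injective h)
  · rintro ⟨hU, hn⟩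
    refine ⟨Fintype.equivFinOfCardEq hn, fun x y => ?_⟩
    by_cases hxy : x = y
    · subst hxy
      simp
    · rw [if_pos]
      · exact hU x (Finset.mem_univ _) y (Finset.mem_univ _) hxy
      · exact fun h => hxy ((Fintype.equivFinOfCardEq hn).injective h)

lemma isIsomorphic_inflation_cycle_iff (hE : E(G).Finite) {s n : ℕ} :
    G.IsIsomorphic (inflation s (cycle n)) ↔ ∃ f : V(G) ≃ Fin n, ∀ x y,
      G.edgeMult.m x y = if (SimpleGraph.cycleGraph n).Adj (f x) (f y) then s else 0 :=
  isIsomorphic_inflation_iff hE s _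

lemma isRegularOfDegree_iff (hE : E(G).Finite) {d : ℕ} :
    G.IsRegularOfDegree d ↔ ∀ v, G.edgeMult.degIn Finset.univ v = d := by
  simp [IsRegularOfDegree, ← degree_eq_degIn hE]

end Graph

/-! ### The ceiling of Δ/t and the main theorem -/

lemma ceil_div_le_iff {d t k : ℕ} (ht : 0 < t) : ⌈(d : ℚ) / (t : ℚ)⌉₊ ≤ k ↔ d ≤ k * t := by
  rw [Nat.ceil_le, div_le_iff₀ (by exact_mod_cast ht)]
  exact_mod_cast Iff.rfl

lemma ceil_mul_div {t k : ℕ} (ht : 0 < t) : ⌈((k * t : ℕ) : ℚ) / (t : ℚ)⌉₊ = k := by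
  have : (t : ℚ) ≠ 0 := by exact_mod_cast ht.ne'
  push_cast
  rw [mul_div_cancel_right₀ _ this, Nat.ceil_natCast]

theorem theorem3p6 {α β : Type*} (t : ℕ) (ht : 1 ≤ t) (G : Graph α β) [G.Loopless]
    (hV : V(G).Finite) (hE : E(G).Finite) (hG : G.Connected) :
    G.pointPartitionNumber t ≤ ⌈(G.maxDegree : ℚ) / (t : ℚ)⌉₊ + 1 ∧
    (G.pointPartitionNumber t = ⌈(G.maxDegree : ℚ) / (t : ℚ)⌉₊ + 1 ↔
      (∃ s p : ℕ, 1 ≤ s ∧ s ≤ t ∧ s ∣ t ∧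
        G.IsIsomorphic (Graph.inflation s (Graph.complete (t / s * p + 1))) ∧
        G.pointPartitionNumber t = p + 1) ∨
      (∃ n : ℕ, 3 ≤ n ∧ Odd n ∧ G.IsIsomorphic (Graph.inflation t (Graph.cycle n)) ∧
        G.pointPartitionNumber t = 3) ∨
      (G.IsRegularOfDegree t ∧ G.pointPartitionNumber t = 2)) ∧
    -- the values of the point partition number in the three cases are automatic
    (∀ s p : ℕ, 1 ≤ s → s ≤ t → s ∣ t →
      G.IsIsomorphic (Graph.inflation s (Graph.complete (t / s * p + 1))) →
      G.pointPartitionNumber t = p + 1) ∧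
    (∀ n : ℕ, 3 ≤ n → Odd n → G.IsIsomorphic (Graph.inflation t (Graph.cycle n)) →
      G.pointPartitionNumber t = 3) ∧
    (G.IsRegularOfDegree t → G.pointPartitionNumber t = 2) := by
  classical
  have := hV.fintype
  have hl := hG.linked hE
  obtain ⟨v₀, hv₀⟩ := hG.1
  have : Nonempty V(G) := ⟨⟨v₀, hv₀⟩⟩
  have hle {k : ℕ} := Graph.pointPartitionNumber_le_iff hE ht (G := G) (k := k)
  have hdeg : ∀ v, G.edgeMult.degIn Finset.univ v ≤ G.maxDegree := fun v => by
    rw [← Graph.degree_eq_degIn hE]; exact Graph.degree_le_maxDegree v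
  have hmax : ∀ d, (∀ v, G.edgeMult.degIn Finset.univ v = d) → G.maxDegree = d := fun d h =>
    Graph.maxDegree_of_forall hG.1 fun v => (Graph.degree_eq_degIn hE v).trans (h v)
  have hupper : G.pointPartitionNumber t ≤ ⌈(G.maxDegree : ℚ) / (t : ℚ)⌉₊ + 1 := by
    refine hle.2 (EdgeMult.exists_good_of_sparse ?_)
    rw [Fintype.card_fin]
    have h1 := (ceil_div_le_iff ht).1 (le_refl ⌈(G.maxDegree : ℚ) / (t : ℚ)⌉₊)
    have h2 := fun v => (hdeg v).trans h1
    refine EdgeMult.sparse_univ_of_lt (v := ⟨v₀, hv₀⟩) hl (fun v => (h2 v).trans ?_)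
      ((h2 _).trans_lt ?_) <;> rw [Nat.add_mul] <;> omega
  -- maximum degrees in the three cases
  have hcA : ∀ s p : ℕ, s ∣ t →
      G.IsIsomorphic (Graph.inflation s (Graph.complete (t / s * p + 1))) →
      ⌈(G.maxDegree : ℚ) / (t : ℚ)⌉₊ = p := by
    intro s p hst hiso
    obtain ⟨hU, hcard⟩ := (Graph.isIsomorphic_inflation_complete_iff hE).1 hiso
    rw [hmax (p * t), ceil_mul_div ht]
    intro v
    rw [hU.degIn (Finset.mem_univ v), Finset.card_univ, hcard, Nat.add_sub_cancel, ← mul_assoc,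
      Nat.mul_div_cancel' hst, mul_comm]
  have hcB : ∀ n : ℕ, 3 ≤ n → G.IsIsomorphic (Graph.inflation t (Graph.cycle n)) →
      ⌈(G.maxDegree : ℚ) / (t : ℚ)⌉₊ = 2 := by
    intro n hn hiso
    obtain ⟨f, hf⟩ := (Graph.isIsomorphic_inflation_cycle_iff hE).1 hiso
    rw [hmax (2 * t) (EdgeMult.degIn_univ_of_cycle hn f hf), ceil_mul_div ht]
  have hcC : G.IsRegularOfDegree t → ⌈(G.maxDegree : ℚ) / (t : ℚ)⌉₊ = 1 := by
    intro hreg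
    rw [hmax (1 * t) (by simpa using (Graph.isRegularOfDegree_iff hE).1 hreg), ceil_mul_div ht]
  have hA : ∀ s p : ℕ, 1 ≤ s → s ∣ t →
      G.IsIsomorphic (Graph.inflation s (Graph.complete (t / s * p + 1))) →
      G.pointPartitionNumber t = p + 1 := by
    intro s p hs hst hiso
    refine le_antisymm (by rwa [hcA s p hst hiso] at hupper) ?_
    obtain ⟨c, hc⟩ := hle.1 le_rfl
    obtain ⟨hU, hcard⟩ := (Graph.isIsomorphic_inflation_complete_iff hE).1 hiso
    simpa using hU.card_lt_of_good hs ht hst hcard hc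
  have hB : ∀ n : ℕ, 3 ≤ n → Odd n → G.IsIsomorphic (Graph.inflation t (Graph.cycle n)) →
      G.pointPartitionNumber t = 3 := by
    intro n hn hodd hiso
    refine le_antisymm (by rwa [hcB n hn hiso] at hupper) ?_
    by_contra! hlt
    obtain ⟨c, hc⟩ := hle.1 (Nat.le_of_lt_succ hlt)
    obtain ⟨f, hf⟩ := (Graph.isIsomorphic_inflation_cycle_iff hE).1 hiso
    exact EdgeMult.not_good_of_odd_cycle (by omega) hodd f hf c hc
  have hC : G.IsRegularOfDegree t → G.pointPartitionNumber t = 2 := by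
    intro hreg
    refine le_antisymm (by rwa [hcC hreg] at hupper) ?_
    by_contra! hlt
    obtain ⟨c, hc⟩ := hle.1 (Nat.le_of_lt_succ hlt)
    exact EdgeMult.not_good_of_regular ((Graph.isRegularOfDegree_iff hE).1 hreg) c hc
  refine ⟨hupper, ⟨fun heq => ?_, ?_⟩, fun s p hs _ => hA s p hs, hB, hC⟩
  · have hk := (ceil_div_le_iff ht).1 (le_refl ⌈(G.maxDegree : ℚ) / (t : ℚ)⌉₊)
    generalize ⌈(G.maxDegree : ℚ) / (t : ℚ)⌉₊ = k at hk heq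
    have hdegk := fun v => (hdeg v).trans hk
    have hnot : ¬ ∃ c : V(G) → Fin k, G.edgeMult.Good t c := fun h => by
      have := hle.2 h
      omega
    rcases Nat.lt_or_ge k 2 with hk2 | hk2
    -- For k = 0 there are no edges, so the connected graph is one vertex: case (a) with s = t and p
    -- = 0. For k = 1 a vertex of degree below t would make one color suffice.
    · interval_cases k
      · refine .inl ⟨t, 0, ht, le_rfl, dvd_rfl, ?_, heq⟩
        rw [Graph.isIsomorphic_inflation_complete_iff hE]
        have hcard : Fintype.card V(G) = 1 := by
          rw [Fintype.card_eq_one_iff]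
          refine ⟨⟨v₀, hv₀⟩, fun y => ?_⟩
          have : (Finset.univ : Finset V(G)) ⊆ {⟨v₀, hv₀⟩} := by
            refine hl.subset_of_closed (Finset.mem_univ ⟨v₀, hv₀⟩) (by simp) ?_
            intro y _ _ z hz hyz
            have h1 := (EdgeMult.m_le_degIn (M := G.edgeMult) hz y).trans (hdegk y)
            omega
          simpa using this (Finset.mem_univ y)
        refine ⟨fun x _ y _ hxy => absurd ?_ hxy, by simpa using hcard⟩
        exact (Fintype.card_le_one_iff.1 hcard.le) x y
      · refine .inr (.inr ⟨(Graph.isRegularOfDegree_iff hE).2 fun v => ?_, heq⟩)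
        refine (by simpa using hdegk v : _ ≤ t).antisymm ?_
        by_contra! hlt
        refine hnot (EdgeMult.exists_good_of_sparse ?_)
        rw [Fintype.card_fin]
        exact EdgeMult.sparse_univ_of_lt hl hdegk (by simpa using hlt)
    · rcases EdgeMult.exists_good_or ht hl hk2 hdegk with h | ⟨s, hs, hst, hU, hcard⟩ |
        ⟨rfl, n, hn, hodd, f, hf⟩
      · exact absurd h hnot
      · refine .inl ⟨s, k, hs, Nat.le_of_dvd ht hst, hst, ?_, heq⟩
        rw [Graph.isIsomorphic_inflation_complete_iff hE]
        refine ⟨hU, ?_⟩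
        have h1 : Fintype.card V(G) - 1 = t / s * k := by
          refine Nat.eq_of_mul_eq_mul_left hs ?_
          rw [hcard, ← mul_assoc, Nat.mul_div_cancel' hst, mul_comm]
        have h2 : 0 < Fintype.card V(G) := Fintype.card_pos
        omega
      · exact .inr (.inl ⟨n, hn, hodd, (Graph.isIsomorphic_inflation_cycle_iff hE).2 ⟨f, hf⟩, heq⟩)
  · rintro (⟨s, p, -, -, hst, hiso, h⟩ | ⟨n, hn, -, hiso, h⟩ | ⟨hreg, h⟩)
    · rw [h, hcA s p hst hiso]
    · rw [h, hcB n hn hiso]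
    · rw [h, hcC hreg]
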